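/- Let $\mu$ and $\nu$ be probability distributions on $\mathbb{N}=\{0,1,2,\dots\}$ with $\mu(1)<1$ and $\nu(0)>0$, and with generating functions $f(s)=\sum_{n}s^n\mu(n)$ and $g(s)=\sum_n s^n\nu(n)$. Assume (SL): there are constants $c,d>0$ and $\alpha\in(0,1]$ and functions $\mathcal{l},\mathcal{k}:(0,1)\to(0,\infty)$, slowly varying at zero and with $\mathcal{l}(s)/\mathcal{k}(s)\to1$ as $s\to0$, such that $$f(s)=s+c(1-s)^{1+\alpha}\mathcal{l}(1-s)\quad\text{and}\quad g(s)=1-d(1-s)^{\alpha}\mathcal{k}(1-s),\qquad s\in(0,1).$$ Put $\delta=\frac{d}{c\alpha}$. Let $Z_1$ be a Bienaymé–Galton–Watson process with immigration, started at $0$, with offspring distribution $\mu$ and immigration distribution $\nu$; that is, $Z_1$ has the same law as the solution of $$Z_1(k)=X_1(C_1(k))+Y_1(k),\qquad C_1(k)=\sum_{0\le j<k}Z_1(j),\qquad k\in\mathbb{N},$$ where $X_1$ and $Y_1$ are independent random walks started at $0$, the jumps of $X_1$ having the distribution $k\mapsto\mu(k+1)$ on $\{-1,0,1,\dots\}$ and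 those of $Y_1$ the distribution $\nu$. Extend $Z_1$ to continuous time by $s\mapsto Z_1(\lfloor s\rfloor)$ and let $d_1(Z_1)=\inf\{s>1: Z_1(\lfloor s\rfloor)=0\}$ (with $\inf\emptyset=\infty$), which is the first return time $\inf\{m\ge1: Z_1(m)=0\}$ of $Z_1$ to zero. Then there exists a function $\mathcal{l}^*:[0,\infty)\to(0,\infty)$, slowly varying at infinity, such that $$\mathbb{P}(Z_1(n)=0)\sim \mathcal{l}^*(n)\,n^{-\delta}\qquad\text{as }n\to\infty.$$ If moreover $\delta\in(0,1)$, then, with the same function $\mathcal{l}^*$, $$\mathbb{P}(d_1(Z_1)>n)\sim\frac{1}{\Gamma(\delta)\Gamma(1-\delta)\,\mathcal{l}^*(n)\,n^{1-\delta}}=\frac{\sin(\pi\delta)}{\pi}\,\frac{n^{\delta-1}}{\mathcal{l}^*(n)}\qquad\text{as }n\to\infty.$$ (Slowly varying functions are, as usual, positive and measurable, and $h$ is slowly varying at $a\in\{0,\infty\}$ if $h(\lambda x)/h(x)\to1$ as $x\to a$ for every $\lambda>0$.) -/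

import Mathlib

open MeasureTheory ProbabilityTheory Filter Topology Asymptotics Set
open scoped NNReal ENNReal

/-- `h : (0,1) → (0,∞)` is slowly varying at zero (only the values of `h` on `(0,1)` matter). -/
structure SlowlyVaryingAtZero (h : ℝ → ℝ) : Prop where
  pos : ∀ x ∈ Ioo (0 : ℝ) 1, 0 < h x
  measurable : Measurable ((Ioo (0 : ℝ) 1).domRestrict h)
  tendsto_div : ∀ a : ℝ, 0 < a → Tendsto (fun x => h (a * x) / h x) (𝓝[>] 0) (𝓝 1)

/-- `h : [0,∞) → (0,∞)` is slowly varying at infinity (only the values of `h` on `[0,∞)`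
matter). -/
structure SlowlyVaryingAtInfinity (h : ℝ → ℝ) : Prop where
  pos : ∀ x ∈ Ici (0 : ℝ), 0 < h x
  measurable : Measurable ((Ici (0 : ℝ)).domRestrict h)
  tendsto_div : ∀ a : ℝ, 0 < a → Tendsto (fun x => h (a * x) / h x) atTop (𝓝 1)

/-- The generating function `s ↦ ∑ₙ sⁿ p(n)` of a distribution `p` on `ℕ`. -/
noncomputable def genFun (p : PMF ℕ) (s : ℝ) : ℝ := ∑' n : ℕ, s ^ n * (p n).toReal

/-- Assumption (SL) on the offspring distribution `μ` and the immigration distribution `ν`, with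
constants `c, d > 0` and `α ∈ (0,1]`. -/
structure AssumptionSL (μ ν : PMF ℕ) (c d α : ℝ) : Prop where
  c_pos : 0 < c
  d_pos : 0 < d
  α_pos : 0 < α
  α_le_one : α ≤ 1
  exists_slowlyVarying : ∃ l k : ℝ → ℝ, SlowlyVaryingAtZero l ∧ SlowlyVaryingAtZero k ∧
    Tendsto (fun s => l s / k s) (𝓝[>] 0) (𝓝 1) ∧
    (∀ s ∈ Ioo (0 : ℝ) 1, genFun μ s = s + c * (1 - s) ^ (1 + α) * l (1 - s)) ∧
    (∀ s ∈ Ioo (0 : ℝ) 1, genFun ν s = 1 - d * (1 - s) ^ α * k (1 - s))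

/-- `S` is, under `P`, a random walk on `ℤ` started at `0` with jump distribution `ρ`. -/
structure IsRandomWalk {Ω : Type*} [MeasurableSpace Ω] (ρ : PMF ℤ) (S : ℕ → Ω → ℤ)
    (P : Measure Ω) : Prop where
  measurable : ∀ n, Measurable (S n)
  zero : ∀ ω, S 0 ω = 0
  indep : iIndepFun (fun n ω => S (n + 1) ω - S n ω) P
  law : ∀ n, P.map (fun ω => S (n + 1) ω - S n ω) = ρ.toMeasure

/-- `Z` is, under `P`, a Bienaymé–Galton–Watson process with immigration started at `0`, with
offspring distribution `μ` and immigration distribution `ν`: as a random path it has the same law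
as the solution `Z'` of the recursion `Z' = X ∘ C + Y`, `C k = ∑_{0 ≤ j < k} Z' j`, where `X` and
`Y` are independent random walks, the jumps of `X` being distributed as `ξ - 1` with `ξ ∼ μ` and
those of `Y` having distribution `ν`. -/
def IsBGWI {Ω : Type*} [MeasurableSpace Ω] (μ ν : PMF ℕ) (Z : ℕ → Ω → ℕ)
    (P : Measure Ω) : Prop :=
  ∃ (Ω' : Type) (_ : MeasurableSpace Ω') (P' : Measure Ω') (X Y : ℕ → Ω' → ℤ)
    (Z' : ℕ → Ω' → ℕ),
    IsProbabilityMeasure P' ∧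
    IsRandomWalk (μ.map fun j : ℕ => (j : ℤ) - 1) X P' ∧
    IsRandomWalk (ν.map fun j : ℕ => (j : ℤ)) Y P' ∧
    IndepFun (fun ω n => X n ω) (fun ω n => Y n ω) P' ∧
    (∀ ω n, (Z' n ω : ℤ) = X (∑ j ∈ Finset.range n, Z' j ω) ω + Y n ω) ∧
    IdentDistrib (fun ω n => Z n ω) (fun ω n => Z' n ω) P P'

/-- `d_t(z) = inf {s > t : z(s) = 0} ∈ [0,∞]` for a path `z` indexed by `[0,∞)`, with
`inf ∅ = ∞`. -/
noncomputable def zeroAfter (t : ℝ≥0) (z : ℝ≥0 → ℕ) : ℝ≥0∞ :=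
  sInf ((fun s : ℝ≥0 => (s : ℝ≥0∞)) '' {s | t < s ∧ z s = 0})

/-- The continuous-time extension `s ↦ z(⌊s⌋)` of a path `z` indexed by `ℕ`. -/
noncomputable def stepPath (z : ℕ → ℕ) : ℝ≥0 → ℕ := fun s => z ⌊s⌋₊

/-!
Why the asymptotics hold.

Let `f`, `g` be the generating functions of `μ`, `ν` and `f_j` the iterates of `f`. The process is
a Markov chain whose transition law from `z` has the generating function `f ^ z * g`
(`IsBGWI.map_path`, `egenFun_bgwiKernel`), so `u n = ℙ(Z n = 0) = ∏_{j < n} g (f_j 0)`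
(`measure_apply_eq_zero`).

Put `q n = 1 - f_n 0` and `A v = 1 - (1 - f (1 - v)) / v`, which is `c v ^ α l(v)` on `(0, 1)`. Then
`q (n + 1) = q n (1 - A (q n))`, and `v A v` is convex because `f` is. Convexity turns the regular
variation of `A` into regular variation of the slopes of `v A v`, and this gives
`1 / A (q (n + 1)) - 1 / A (q n) → α`, hence `n A (q n) → 1 / α` (`tendsto_nat_mul_of_iterate`).
Consequently `n (1 - u (n + 1) / u n) → d / (c α) = δ` (`AssumptionSL.tendsto_nat_mul`), and a
positive sequence with this property is regularly varying with index `-δ`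
(`tendsto_div_of_tendsto_nat_mul`). The slowly varying function is `u ⌊x⌋ (x + 1) ^ δ`.

For the return time let `r n` be the probability that the chain avoids `0` at the times `1, …, n`.
Decomposing at the last zero gives `∑_{k ≤ n} u k r (n - k) = 1` (`sum_measure_mul_lastZeroSet`),
so the product of the generating functions of `u` and `r` at `e^{-λ}` is `1 / (1 - e^{-λ})`.
If `δ < 1` the Laplace transform of `u` is determined asymptotically by an Abelian theorem
(`tendsto_laplace_of_regularlyVarying`), hence so is that of `r`, and Karamata's Tauberian theorem
for monotone sequences (`tendsto_of_tendsto_laplace_of_antitone`) gives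
`n u n r n → 1 / (Γ(δ) Γ(1 - δ))`.
-/

/-! ### Independence of the jumps and the transition law -/

/-- The one-step transition law of a Bienaymé–Galton–Watson process with immigration: the law of
the sum of `z` independent `μ`-distributed variables and one independent `ν`-distributed
variable. -/
noncomputable def bgwiKernel (μ ν : PMF ℕ) : ℕ → PMF ℕ
  | 0 => ν
  | z + 1 => μ.bind fun x => (bgwiKernel μ ν z).map fun y => x + y

/-- The law of a sum of two independent integer variables, as the bind of their laws. -/
theorem map_add_eq_bind_toMeasure {Ω : Type*} [MeasurableSpace Ω] {P : Measure Ω}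
    {A B : Ω → ℤ} (hA : Measurable A) (hB : Measurable B) (hAB : IndepFun A B P) {p q : PMF ℤ}
    (hp : P.map A = p.toMeasure) (hq : P.map B = q.toMeasure) :
    P.map (fun ω => A ω + B ω) = (p.bind fun a => q.map fun b => a + b).toMeasure := by
  refine Measure.ext_of_singleton fun w => ?_
  have hAB' : Measurable fun ω => A ω + B ω := hA.add hB
  rw [Measure.map_apply hAB' (measurableSet_singleton w),
    PMF.toMeasure_apply_singleton _ _ (measurableSet_singleton w), PMF.bind_apply]
  have hset : (fun ω => A ω + B ω) ⁻¹' {w} = ⋃ a : ℤ, A ⁻¹' {a} ∩ B ⁻¹' {w - a} := by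
    ext ω
    simp only [mem_preimage, mem_singleton_iff, mem_iUnion, mem_inter_iff]
    constructor
    · intro h; exact ⟨A ω, rfl, by omega⟩
    · rintro ⟨a, h1, h2⟩; omega
  rw [hset, measure_iUnion]
  · refine tsum_congr fun a => ?_
    rw [hAB.measure_inter_preimage_eq_mul _ _ (measurableSet_singleton a)
      (measurableSet_singleton _), ← Measure.map_apply hA (measurableSet_singleton a),
      ← Measure.map_apply hB (measurableSet_singleton _), hp, hq,
      PMF.toMeasure_apply_singleton _ _ (measurableSet_singleton _),
      PMF.toMeasure_apply_singleton _ _ (measurableSet_singleton _)]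
    congr 1
    rw [PMF.map_apply, tsum_eq_single (w - a)]
    · simp
    · intro b hb
      rw [if_neg (by omega)]
  · intro a b hab
    refine Set.disjoint_left.2 fun ω h1 h2 => hab ?_
    simp only [mem_inter_iff, mem_preimage, mem_singleton_iff] at h1 h2
    omega
  · exact fun a => (hA (measurableSet_singleton a)).inter (hB (measurableSet_singleton _))

/-- Two independent processes, each with independent coordinates, form together one independent
family. -/
theorem iIndepFun_sumElim {Ω ι κ E : Type*} [MeasurableSpace Ω] [MeasurableSpace E]
    {P : Measure Ω} {V : ι → Ω → E} {W : κ → Ω → E} (hV : iIndepFun V P) (hW : iIndepFun W P)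
    (hVW : IndepFun (fun ω i => V i ω) (fun ω i => W i ω) P) :
    iIndepFun (Sum.elim V W) P := by
  classical
  rw [iIndepFun_iff_measure_inter_preimage_eq_mul]
  intro S A hA
  have hmem : ∀ i ∈ S.toLeft, MeasurableSet (A (Sum.inl i)) :=
    fun i hi => hA _ (Finset.mem_toLeft.1 hi)
  have hmem' : ∀ i ∈ S.toRight, MeasurableSet (A (Sum.inr i)) :=
    fun i hi => hA _ (Finset.mem_toRight.1 hi)
  have h1 := hV.measure_inter_preimage_eq_mul S.toLeft (sets := fun i => A (Sum.inl i)) hmem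
  have h2 := hW.measure_inter_preimage_eq_mul S.toRight (sets := fun i => A (Sum.inr i)) hmem'
  have h3 := hVW.measure_inter_preimage_eq_mul (⋂ i ∈ S.toLeft, (fun x => x i) ⁻¹' A (Sum.inl i))
    (⋂ i ∈ S.toRight, (fun x => x i) ⁻¹' A (Sum.inr i))
    (Finset.measurableSet_biInter _ fun i hi => measurable_pi_apply i (hmem i hi))
    (Finset.measurableSet_biInter _ fun i hi => measurable_pi_apply i (hmem' i hi))
  have hset : (⋂ i ∈ S, Sum.elim V W i ⁻¹' A i) =
      ((fun ω i => V i ω) ⁻¹' (⋂ i ∈ S.toLeft, (fun x => x i) ⁻¹' A (Sum.inl i))) ∩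
      ((fun ω i => W i ω) ⁻¹' (⋂ i ∈ S.toRight, (fun x => x i) ⁻¹' A (Sum.inr i))) := by
    ext ω
    simp only [mem_iInter, mem_preimage, mem_inter_iff, Finset.mem_toLeft, Finset.mem_toRight]
    constructor
    · intro h; exact ⟨fun i hi => h _ hi, fun i hi => h _ hi⟩
    · rintro ⟨ha, hb⟩ (i | i) hi
      · exact ha i hi
      · exact hb i hi
  have hprod : ∏ i ∈ S, P (Sum.elim V W i ⁻¹' A i) =
      (∏ i ∈ S.toLeft, P (V i ⁻¹' A (Sum.inl i))) *
      ∏ i ∈ S.toRight, P (W i ⁻¹' A (Sum.inr i)) := by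
    conv_lhs => rw [← Finset.toLeft_disjSum_toRight (u := S), Finset.prod_disjSum]
    simp
  rw [hset, h3, hprod, ← h1, ← h2]
  congr 2
  · ext; simp
  · ext; simp

/-- The σ-algebra generated by the jumps of `X` at the times `j` with `Sum.inl j ∈ S` and by the
jumps of `Y` at the times `j` with `Sum.inr j ∈ S`. -/
@[reducible]
def jumpSigma {Ω : Type*} (X Y : ℕ → Ω → ℤ) (S : Set (ℕ ⊕ ℕ)) : MeasurableSpace Ω :=
  ⨆ i ∈ S, MeasurableSpace.comap (Sum.elim (fun n ω => X (n + 1) ω - X n ω)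
    (fun n ω => Y (n + 1) ω - Y n ω) i) ⊤

theorem measurable_jump_left {Ω : Type*} {X Y : ℕ → Ω → ℤ} {S : Set (ℕ ⊕ ℕ)} {j : ℕ}
    (hj : Sum.inl j ∈ S) : Measurable[jumpSigma X Y S] fun ω => X (j + 1) ω - X j ω :=
  (comap_measurable (fun ω => X (j + 1) ω - X j ω)).mono
    (le_iSup₂_of_le (f := fun i _ => MeasurableSpace.comap (Sum.elim
      (fun n ω => X (n + 1) ω - X n ω) (fun n ω => Y (n + 1) ω - Y n ω) i) ⊤) _ hj le_rfl) le_rfl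

theorem measurable_jump_right {Ω : Type*} {X Y : ℕ → Ω → ℤ} {S : Set (ℕ ⊕ ℕ)} {j : ℕ}
    (hj : Sum.inr j ∈ S) : Measurable[jumpSigma X Y S] fun ω => Y (j + 1) ω - Y j ω :=
  (comap_measurable (fun ω => Y (j + 1) ω - Y j ω)).mono
    (le_iSup₂_of_le (f := fun i _ => MeasurableSpace.comap (Sum.elim
      (fun n ω => X (n + 1) ω - X n ω) (fun n ω => Y (n + 1) ω - Y n ω) i) ⊤) _ hj le_rfl) le_rfl

/-- An increment of a path is measurable with respect to the jumps over its time interval. -/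
theorem measurable_increment {Ω : Type*} {D : ℕ → Ω → ℤ} {m : MeasurableSpace Ω} {a b : ℕ}
    (hab : a ≤ b) (hD : ∀ j, a ≤ j → j < b → Measurable[m] fun ω => D (j + 1) ω - D j ω) :
    Measurable[m] fun ω => D b ω - D a ω := by
  have h : (fun ω => D b ω - D a ω) =
      fun ω => ∑ j ∈ Finset.Ico a b, (D (j + 1) ω - D j ω) := by
    ext ω
    rw [Finset.sum_Ico_sub (fun j => D j ω) hab]
  rw [h]
  exact Finset.measurable_fun_sum _ fun j hj =>
    hD j (Finset.mem_Ico.1 hj).1 (Finset.mem_Ico.1 hj).2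

section walks

variable {Ω : Type*} [MeasurableSpace Ω] {P : Measure Ω} {μ ν : PMF ℕ} {X Y : ℕ → Ω → ℤ}

theorem indep_jumpSigma {ρ σ : PMF ℤ} (hX : IsRandomWalk ρ X P) (hY : IsRandomWalk σ Y P)
    (hXY : IndepFun (fun ω n => X n ω) (fun ω n => Y n ω) P) {S T : Set (ℕ ⊕ ℕ)}
    (hST : Disjoint S T) : Indep (jumpSigma X Y S) (jumpSigma X Y T) P := by
  have hd : Measurable fun (x : ℕ → ℤ) n => x (n + 1) - x n := by fun_prop
  have h := iIndepFun_sumElim hX.indep hY.indep (hXY.comp hd hd)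
  refine indep_iSup_of_disjoint (fun i => ?_) h.iIndep hST
  rcases i with n | n
  · exact ((hX.measurable (n + 1)).sub (hX.measurable n)).comap_le
  · exact ((hY.measurable (n + 1)).sub (hY.measurable n)).comap_le

/-- The number of children of `m` individuals plus the immigrants of one generation has the law
`bgwiKernel μ ν m`. -/
theorem map_increment_eq_bgwiKernel
    (hX : IsRandomWalk (μ.map fun j : ℕ => (j : ℤ) - 1) X P)
    (hY : IsRandomWalk (ν.map fun j : ℕ => (j : ℤ)) Y P)
    (hXY : IndepFun (fun ω n => X n ω) (fun ω n => Y n ω) P) (c n m : ℕ) :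
    P.map (fun ω => (X (c + m) ω - X c ω) + m + (Y (n + 1) ω - Y n ω)) =
      ((bgwiKernel μ ν m).map fun j : ℕ => (j : ℤ)).toMeasure := by
  induction m with
  | zero => simpa [bgwiKernel] using hY.law n
  | succ m ih =>
    have hind := indep_jumpSigma hX hY hXY (S := {Sum.inl (c + m)})
      (T := {i | (∃ j < c + m, i = Sum.inl j) ∨ i = Sum.inr n}) (by
        rw [Set.disjoint_singleton_left]
        rintro (⟨j, hj, h⟩ | h)
        · simp only [Sum.inl.injEq] at h; omega
        · simp at h)
    have hA : Measurable[jumpSigma X Y {Sum.inl (c + m)}]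
        fun ω => (X (c + m + 1) ω - X (c + m) ω) + 1 :=
      (measurable_jump_left (j := c + m) (Set.mem_singleton _)).add_const 1
    have hB : Measurable[jumpSigma X Y {i | (∃ j < c + m, i = Sum.inl j) ∨ i = Sum.inr n}]
        fun ω => (X (c + m) ω - X c ω) + m + (Y (n + 1) ω - Y n ω) := by
      refine Measurable.add (Measurable.add_const (measurable_increment (by omega) ?_) _) ?_
      · intro j _ hj
        exact measurable_jump_left (Or.inl ⟨j, hj, rfl⟩)
      · exact measurable_jump_right (Or.inr rfl)
    have hAB : IndepFun (fun ω => (X (c + m + 1) ω - X (c + m) ω) + 1)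
        (fun ω => (X (c + m) ω - X c ω) + m + (Y (n + 1) ω - Y n ω)) P := by
      rw [IndepFun_iff_Indep]
      exact indep_of_indep_of_le_left (indep_of_indep_of_le_right hind hB.comap_le) hA.comap_le
    have hXm := hX.measurable
    have hYm := hY.measurable
    have hlaw : P.map (fun ω => (X (c + m + 1) ω - X (c + m) ω) + 1) =
        (μ.map fun j : ℕ => (j : ℤ)).toMeasure := by
      have h := congrArg (Measure.map fun k : ℤ => k + 1) (hX.law (c + m))
      rw [Measure.map_map .of_discrete (by fun_prop),
        PMF.toMeasure_map (fun k : ℤ => k + 1) _ .of_discrete, PMF.map_comp] at h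
      simpa [Function.comp_def] using h
    have := map_add_eq_bind_toMeasure (by fun_prop) (by fun_prop) hAB hlaw ih
    convert this using 2
    · ext ω; push_cast; rw [← add_assoc c m 1]; ring
    · simp only [bgwiKernel, PMF.map_bind, PMF.bind_map, PMF.map_comp]
      congr 1

end walks

/-- The Markov property on cylinder sets: the law of a Bienaymé–Galton–Watson process with
immigration gives to each finite path the product of its transition probabilities. -/
theorem IsBGWI.map_path {Ω : Type*} [MeasurableSpace Ω] {P : Measure Ω} {μ ν : PMF ℕ}
    {Z : ℕ → Ω → ℕ} (hZ : IsBGWI μ ν Z P) :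
    P.map (fun ω n => Z n ω) {x | x 0 = 0} = 1 ∧ ∀ (n : ℕ) (z : ℕ → ℕ),
      P.map (fun ω n => Z n ω) {x | ∀ i ≤ n + 1, x i = z i} =
        P.map (fun ω n => Z n ω) {x | ∀ i ≤ n, x i = z i} * bgwiKernel μ ν (z n) (z (n + 1)) := by
  obtain ⟨Ω', _, P', X, Y, Z', hP', hX, hY, hXY, hrec, hid⟩ := hZ
  have hm : ∀ n (z : ℕ → ℕ), MeasurableSet {x : ℕ → ℕ | ∀ i ≤ n, x i = z i} := by
    intro n z
    simp only [ofPred_forall]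
    exact MeasurableSet.iInter fun i => MeasurableSet.iInter fun _ =>
      measurableSet_eq_fun (measurable_pi_apply i) measurable_const
  rw [hid.map_eq]
  constructor
  · rw [Measure.map_apply_of_aemeasurable hid.aemeasurable_snd
      (measurableSet_eq_fun (measurable_pi_apply 0) measurable_const :
        MeasurableSet {x : ℕ → ℕ | x 0 = 0})]
    have : (fun ω n => Z' n ω) ⁻¹' {x | x 0 = 0} = univ := by
      ext ω
      have := hrec ω 0
      simp only [Finset.range_zero, Finset.sum_empty, hX.zero, hY.zero] at this
      simpa using this
    rw [this, measure_univ]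
  · intro n z
    rw [Measure.map_apply_of_aemeasurable hid.aemeasurable_snd (hm _ z),
      Measure.map_apply_of_aemeasurable hid.aemeasurable_snd (hm _ z)]
    -- On a prescribed path the number of ancestors used so far is deterministic.
    set c : ℕ → ℕ := fun i => ∑ j ∈ Finset.range i, z j with hc
    have hpath : ∀ n, (fun ω n => Z' n ω) ⁻¹' {x | ∀ i ≤ n, x i = z i} =
        {ω | ∀ i ≤ n, (z i : ℤ) = X (c i) ω + Y i ω} := by
      intro n
      ext ω
      simp only [mem_preimage, mem_ofPred_eq]
      constructor
      · intro h i hi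
        rw [← h i hi, hrec ω i, hc]
        simp only
        rw [Finset.sum_congr rfl fun j hj => h j (by have := Finset.mem_range.1 hj; omega)]
      · intro h i
        induction i using Nat.strong_induction_on with
        | _ i ih =>
          intro hi
          have hsum : ∑ j ∈ Finset.range i, Z' j ω = c i :=
            Finset.sum_congr rfl fun j hj => ih j (Finset.mem_range.1 hj)
              (by have := Finset.mem_range.1 hj; omega)
          have h1 := hrec ω i
          have h2 := h i hi
          rw [hsum] at h1
          omega
    have hcs : c (n + 1) = c n + z n := Finset.sum_range_succ _ _
    have hcm : Monotone c := monotone_nat_of_le_succ fun i => by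
      simp [hc, Finset.sum_range_succ]
    have hinter : {ω | ∀ i ≤ n + 1, (z i : ℤ) = X (c i) ω + Y i ω} =
        {ω | ∀ i ≤ n, (z i : ℤ) = X (c i) ω + Y i ω} ∩
        (fun ω => (X (c n + z n) ω - X (c n) ω) + z n + (Y (n + 1) ω - Y n ω)) ⁻¹'
          {(z (n + 1) : ℤ)} := by
      ext ω
      simp only [mem_ofPred_eq, mem_inter_iff, mem_preimage, mem_singleton_iff]
      constructor
      · intro h
        have h1 := h n (by omega)
        have h2 := h (n + 1) le_rfl
        rw [hcs] at h2
        exact ⟨fun i hi => h i (by omega), by omega⟩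
      · rintro ⟨h1, h2⟩ i hi
        rcases Nat.le_add_one_iff.1 hi with hi | rfl
        · exact h1 i hi
        · have := h1 n le_rfl
          rw [hcs]
          omega
    rw [hpath, hpath, hinter]
    have hind := indep_jumpSigma hX hY hXY
      (S := {i | (∃ j < c n, i = Sum.inl j) ∨ (∃ j < n, i = Sum.inr j)})
      (T := {i | (∃ j, c n ≤ j ∧ i = Sum.inl j) ∨ i = Sum.inr n}) (by
        rw [Set.disjoint_left]
        rintro _ (⟨j, hj, rfl⟩ | ⟨j, hj, rfl⟩) (⟨k, hk, h⟩ | h) <;> simp at h <;> omega)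
    have hpast : MeasurableSet[jumpSigma X Y
        {i | (∃ j < c n, i = Sum.inl j) ∨ (∃ j < n, i = Sum.inr j)}]
        {ω | ∀ i ≤ n, (z i : ℤ) = X (c i) ω + Y i ω} := by
      simp only [ofPred_forall]
      refine MeasurableSet.iInter fun i => MeasurableSet.iInter fun hi => ?_
      have h1 := measurable_increment (D := X) (a := 0) (b := c i) (Nat.zero_le _) (fun j _ hj =>
        measurable_jump_left (Y := Y)
          (S := {i | (∃ j < c n, i = Sum.inl j) ∨ (∃ j < n, i = Sum.inr j)})
          (Or.inl ⟨j, lt_of_lt_of_le hj (hcm hi), rfl⟩))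
      have h2 := measurable_increment (D := Y) (a := 0) (b := i) (Nat.zero_le _) (fun j _ hj =>
        measurable_jump_right (X := X)
          (S := {i | (∃ j < c n, i = Sum.inl j) ∨ (∃ j < n, i = Sum.inr j)})
          (Or.inr ⟨j, by omega, rfl⟩))
      simp only [hX.zero, hY.zero, sub_zero] at h1 h2
      have h3 := (h1.add h2) (measurableSet_singleton (z i : ℤ))
      convert h3 using 1
      ext ω
      simp [eq_comm]
    have hfut : MeasurableSet[jumpSigma X Y
        {i | (∃ j, c n ≤ j ∧ i = Sum.inl j) ∨ i = Sum.inr n}]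
        ((fun ω => (X (c n + z n) ω - X (c n) ω) + z n + (Y (n + 1) ω - Y n ω)) ⁻¹'
          {(z (n + 1) : ℤ)}) := by
      refine (Measurable.add (Measurable.add_const (measurable_increment (by omega) ?_) _) ?_)
        (measurableSet_singleton _)
      · intro j hj _
        exact measurable_jump_left (Or.inl ⟨j, hj, rfl⟩)
      · exact measurable_jump_right (Or.inr rfl)
    rw [Indep_iff] at hind
    rw [hind _ _ hpast hfut]
    congr 1
    have hlaw := map_increment_eq_bgwiKernel hX hY hXY (c n) n (z n)
    have hXm := hX.measurable
    have hYm := hY.measurable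
    have hmeas : Measurable fun ω => (X (c n + z n) ω - X (c n) ω) + z n +
        (Y (n + 1) ω - Y n ω) := by fun_prop
    rw [← Measure.map_apply hmeas (measurableSet_singleton _), hlaw,
      PMF.toMeasure_apply_singleton _ _ (measurableSet_singleton _), PMF.map_apply,
      tsum_eq_single (z (n + 1))]
    · simp
    · intro b hb
      rw [if_neg (by exact_mod_cast hb.symm)]

/-! ### The Markov chain: generating functions and the decomposition at the last zero -/

/-- The generating function of `p` with arguments and values in `[0,∞]`. -/
noncomputable def PMF.egenFun (p : PMF ℕ) (s : ℝ≥0∞) : ℝ≥0∞ := ∑' n, p n * s ^ n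

theorem egenFun_map_add (p : PMF ℕ) (x : ℕ) (s : ℝ≥0∞) :
    (p.map fun y => x + y).egenFun s = s ^ x * p.egenFun s := by
  simp only [PMF.egenFun, PMF.map_apply, ← ENNReal.tsum_mul_right, ← ENNReal.tsum_mul_left]
  rw [ENNReal.tsum_comm]
  refine tsum_congr fun y => ?_
  rw [tsum_eq_single (x + y) (fun b hb => by rw [if_neg hb, zero_mul])]
  rw [if_pos rfl, pow_add]
  ring

theorem egenFun_bind (p : PMF ℕ) (q : ℕ → PMF ℕ) (s : ℝ≥0∞) :
    (p.bind q).egenFun s = ∑' x, p x * (q x).egenFun s := by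
  simp only [PMF.egenFun, PMF.bind_apply, ← ENNReal.tsum_mul_right, ← ENNReal.tsum_mul_left]
  rw [ENNReal.tsum_comm]
  simp only [mul_assoc]

theorem egenFun_bgwiKernel (μ ν : PMF ℕ) (z : ℕ) (s : ℝ≥0∞) :
    (bgwiKernel μ ν z).egenFun s = μ.egenFun s ^ z * ν.egenFun s := by
  induction z with
  | zero => simp [bgwiKernel]
  | succ z ih =>
    rw [bgwiKernel, egenFun_bind]
    simp only [egenFun_map_add, ih, ← mul_assoc]
    rw [ENNReal.tsum_mul_right, ENNReal.tsum_mul_right, pow_succ']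
    rfl

/-- The mass of the paths that stay in `A 0, …, A n` up to time `n` and are at `z` at time `n`. -/
noncomputable def pathMass (M : Measure (ℕ → ℕ)) (A : ℕ → Set ℕ) (n z : ℕ) : ℝ≥0∞ :=
  M {x | (∀ i ≤ n, x i ∈ A i) ∧ x n = z}

theorem measurableSet_forall_le_mem (A : ℕ → Set ℕ) (n : ℕ) :
    MeasurableSet {x : ℕ → ℕ | ∀ i ≤ n, x i ∈ A i} := by
  simp only [ofPred_forall]
  exact MeasurableSet.iInter fun i => MeasurableSet.iInter fun _ =>
    measurable_pi_apply i (MeasurableSet.of_discrete (s := A i))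

theorem measurableSet_apply_eq (n z : ℕ) : MeasurableSet {x : ℕ → ℕ | x n = z} :=
  measurableSet_eq_fun (measurable_pi_apply n) measurable_const

/-- A set of paths is the disjoint union of its traces on the values of one coordinate. -/
theorem tsum_measure_inter_apply_eq (M : Measure (ℕ → ℕ)) {F : Set (ℕ → ℕ)}
    (hF : MeasurableSet F) (n : ℕ) : ∑' z, M (F ∩ {x | x n = z}) = M F := by
  rw [← measure_iUnion]
  · congr 1
    ext x
    simp
  · intro a b hab
    refine Set.disjoint_left.2 fun x h1 h2 => hab ?_
    exact h1.2.symm.trans h2.2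
  · exact fun z => hF.inter (measurableSet_apply_eq n z)

theorem tsum_pathMass (M : Measure (ℕ → ℕ)) (A : ℕ → Set ℕ) (n : ℕ) :
    ∑' z, pathMass M A n z = M {x | ∀ i ≤ n, x i ∈ A i} := by
  rw [← tsum_measure_inter_apply_eq M (measurableSet_forall_le_mem A n) n]
  rfl

section chain

variable {M : Measure (ℕ → ℕ)} {K : ℕ → PMF ℕ}

/-- The Markov property for events of the past, from that for paths. -/
theorem measure_pathMass_step [IsFiniteMeasure M]
    (hK : ∀ (n : ℕ) (z : ℕ → ℕ), M {x | ∀ i ≤ n + 1, x i = z i} =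
      M {x | ∀ i ≤ n, x i = z i} * K (z n) (z (n + 1))) (A : ℕ → Set ℕ) (n z w : ℕ) :
    M ({x | (∀ i ≤ n, x i ∈ A i) ∧ x n = z} ∩ {x | x (n + 1) = w}) =
      pathMass M A n z * K z w := by
  -- Both sides are measures of the set of the first `n + 1` coordinates; compare on singletons.
  set q : (ℕ → ℕ) → (Fin (n + 1) → ℕ) := fun x i => x i with hq
  have hqm : Measurable q := by fun_prop
  have hqs : ∀ p : ℕ → ℕ, q ⁻¹' {q p} = {x | ∀ i ≤ n, x i = p i} := by
    intro p
    ext x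
    simp only [mem_preimage, mem_singleton_iff, funext_iff, hq, mem_ofPred_eq]
    exact ⟨fun h i hi => h ⟨i, by omega⟩, fun h i => h i (by omega)⟩
  have hsurj : Function.Surjective q := by
    intro p
    refine ⟨fun i => if h : i < n + 1 then p ⟨i, h⟩ else 0, ?_⟩
    ext i
    simp only [hq]
    rw [dif_pos i.isLt]
  have key : (M.restrict {x | x n = z ∧ x (n + 1) = w}).map q =
      K z w • (M.restrict {x | x n = z}).map q := by
    refine Measure.ext_of_singleton fun p => ?_
    obtain ⟨p, rfl⟩ := hsurj p
    have hs := hqm (measurableSet_singleton (q p))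
    rw [Measure.smul_apply, Measure.map_apply hqm (measurableSet_singleton _),
      Measure.map_apply hqm (measurableSet_singleton _), Measure.restrict_apply hs,
      Measure.restrict_apply hs, hqs, smul_eq_mul, mul_comm]
    by_cases hp : p n = z
    · have h1 : {x : ℕ → ℕ | ∀ i ≤ n, x i = p i} ∩ {x | x n = z ∧ x (n + 1) = w} =
          {x | ∀ i ≤ n + 1, x i = Function.update p (n + 1) w i} := by
        ext x
        simp only [mem_inter_iff, mem_ofPred_eq]
        constructor
        · rintro ⟨h1, h2, h3⟩ i hi
          rcases Nat.le_add_one_iff.1 hi with hi | rfl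
          · rw [Function.update_of_ne (by omega)]; exact h1 i hi
          · simpa using h3
        · intro h
          have h1 : ∀ i ≤ n, x i = p i := fun i hi => by
            have := h i (by omega)
            rwa [Function.update_of_ne (by omega)] at this
          exact ⟨h1, (h1 n le_rfl).trans hp, by simpa using h (n + 1) le_rfl⟩
      have h2 : {x : ℕ → ℕ | ∀ i ≤ n, x i = p i} ∩ {x | x n = z} =
          {x | ∀ i ≤ n, x i = Function.update p (n + 1) w i} := by
        ext x
        simp only [mem_inter_iff, mem_ofPred_eq]
        constructor
        · rintro ⟨h1, _⟩ i hi
          rw [Function.update_of_ne (by omega)]; exact h1 i hi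
        · intro h
          have h1 : ∀ i ≤ n, x i = p i := fun i hi => by
            have := h i hi
            rwa [Function.update_of_ne (by omega)] at this
          exact ⟨h1, (h1 n le_rfl).trans hp⟩
      rw [h1, h2, hK, Function.update_self, Function.update_of_ne (by omega), hp]
    · have h1 : {x : ℕ → ℕ | ∀ i ≤ n, x i = p i} ∩ {x | x n = z ∧ x (n + 1) = w} = ∅ := by
        refine Set.eq_empty_of_forall_notMem fun x hx => hp ?_
        exact (hx.1 n le_rfl).symm.trans hx.2.1
      have h2 : {x : ℕ → ℕ | ∀ i ≤ n, x i = p i} ∩ {x | x n = z} = ∅ := by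
        refine Set.eq_empty_of_forall_notMem fun x hx => hp ?_
        exact (hx.1 n le_rfl).symm.trans hx.2
      rw [h1, h2]
      simp
  have h := congrArg (fun m => m {p : Fin (n + 1) → ℕ | ∀ i : Fin (n + 1), p i ∈ A i}) key
  have hB : MeasurableSet {p : Fin (n + 1) → ℕ | ∀ i : Fin (n + 1), p i ∈ A i} := .of_discrete
  have hpre : q ⁻¹' {p : Fin (n + 1) → ℕ | ∀ i : Fin (n + 1), p i ∈ A i} =
      {x | ∀ i ≤ n, x i ∈ A i} := by
    ext x
    simp only [mem_preimage, hq, mem_ofPred_eq]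
    exact ⟨fun h i hi => h ⟨i, by omega⟩, fun h i => h i (by omega)⟩
  simp only [Measure.smul_apply, smul_eq_mul, Measure.map_apply hqm hB,
    Measure.restrict_apply (hqm hB)] at h
  rw [hpre, mul_comm] at h
  have hmass : pathMass M A n z = M ({x | ∀ i ≤ n, x i ∈ A i} ∩ {x | x n = z}) := rfl
  rw [hmass, ← h]
  congr 1
  ext x
  simp only [mem_inter_iff, mem_ofPred_eq]
  tauto

theorem pathMass_succ [IsFiniteMeasure M]
    (hK : ∀ (n : ℕ) (z : ℕ → ℕ), M {x | ∀ i ≤ n + 1, x i = z i} =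
      M {x | ∀ i ≤ n, x i = z i} * K (z n) (z (n + 1))) (A : ℕ → Set ℕ) (n w : ℕ)
    (hw : w ∈ A (n + 1)) :
    pathMass M A (n + 1) w = ∑' z, pathMass M A n z * K z w := by
  rw [pathMass, ← tsum_measure_inter_apply_eq M
    (F := {x | (∀ i ≤ n + 1, x i ∈ A i) ∧ x (n + 1) = w})
    ((measurableSet_forall_le_mem A (n + 1)).inter (measurableSet_apply_eq (n + 1) w)) n]
  refine tsum_congr fun z => ?_
  rw [← measure_pathMass_step hK]
  congr 1
  ext x
  simp only [mem_inter_iff, mem_ofPred_eq]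
  constructor
  · rintro ⟨⟨h1, h2⟩, h3⟩
    exact ⟨⟨fun i hi => h1 i (by omega), h3⟩, h2⟩
  · rintro ⟨⟨h1, h2⟩, h3⟩
    refine ⟨⟨fun i hi => ?_, h3⟩, h2⟩
    rcases Nat.le_add_one_iff.1 hi with hi | rfl
    · exact h1 i hi
    · rwa [h3]

theorem pathMass_of_notMem (A : ℕ → Set ℕ) (n w : ℕ) (hw : w ∉ A n) : pathMass M A n w = 0 := by
  have : {x : ℕ → ℕ | (∀ i ≤ n, x i ∈ A i) ∧ x n = w} = ∅ :=
    Set.eq_empty_of_forall_notMem fun x hx => hw (hx.2 ▸ hx.1 n le_rfl)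
  rw [pathMass, this, measure_empty]

/-- The probability that a Bienaymé–Galton–Watson process with immigration started at `0` is at
`0` at time `n` is `∏_{j < n} g (f_j 0)`, with `f_j` the iterates of the offspring generating
function `f` and `g` that of the immigration. -/
theorem measure_apply_eq_zero [IsProbabilityMeasure M] {μ ν : PMF ℕ} (h0 : M {x | x 0 = 0} = 1)
    (hK : ∀ (n : ℕ) (z : ℕ → ℕ), M {x | ∀ i ≤ n + 1, x i = z i} =
      M {x | ∀ i ≤ n, x i = z i} * bgwiKernel μ ν (z n) (z (n + 1))) (n : ℕ) :
    M {x | x n = 0} = ∏ j ∈ Finset.range n, ν.egenFun (μ.egenFun^[j] 0) := by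
  set A : ℕ → Set ℕ := fun _ => univ
  have hG : ∀ n s, ∑' z, pathMass M A n z * s ^ z =
      ∏ j ∈ Finset.range n, ν.egenFun (μ.egenFun^[j] s) := by
    intro n
    induction n with
    | zero =>
      intro s
      have hne : ∀ z, z ≠ 0 → pathMass M A 0 z = 0 := by
        intro z hz
        refine measure_mono_null (t := {x | x 0 = 0}ᶜ) ?_
          ((prob_compl_eq_zero_iff (measurableSet_apply_eq 0 0)).2 h0)
        rintro x ⟨_, hx⟩ hx'
        exact hz (hx.symm.trans hx')
      rw [tsum_eq_single 0 fun z hz => by rw [hne z hz, zero_mul]]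
      simpa [pathMass, A] using h0
    | succ n ih =>
      intro s
      simp only [fun w => pathMass_succ hK A n w (mem_univ w), ← ENNReal.tsum_mul_right]
      rw [ENNReal.tsum_comm]
      have : ∀ z, ∑' w, pathMass M A n z * bgwiKernel μ ν z w * s ^ w =
          pathMass M A n z * μ.egenFun s ^ z * ν.egenFun s := by
        intro z
        simp only [mul_assoc]
        rw [ENNReal.tsum_mul_left, ← egenFun_bgwiKernel, PMF.egenFun]
      simp only [this]
      rw [ENNReal.tsum_mul_right, ih, Finset.prod_range_succ', Function.iterate_zero, id]
      simp only [Function.iterate_succ_apply]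
  rw [← hG, tsum_eq_single 0 fun z hz => by simp [hz]]
  simp [pathMass, A]

/-- Paths that are at `0` at time `k` and avoid `0` at the times in `(k, n]`. -/
def lastZeroSet (k n : ℕ) : Set (ℕ → ℕ) := {x | x k = 0 ∧ ∀ i, k < i → i ≤ n → x i ≠ 0}

theorem measurableSet_lastZeroSet (k n : ℕ) : MeasurableSet (lastZeroSet k n) := by
  have : lastZeroSet k n =
      {x | x k = 0} ∩ ⋂ i, ⋂ (_ : k < i), ⋂ (_ : i ≤ n), {x | x i = 0}ᶜ := by
    ext x
    simp [lastZeroSet]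
  rw [this]
  exact (measurableSet_apply_eq k 0).inter <| .iInter fun i => .iInter fun _ => .iInter fun _ =>
    (measurableSet_apply_eq i 0).compl

/-- Regeneration at `0`: after a visit to `0` the chain starts afresh. -/
theorem measure_lastZeroSet [IsProbabilityMeasure M] (h0 : M {x | x 0 = 0} = 1)
    (hK : ∀ (n : ℕ) (z : ℕ → ℕ), M {x | ∀ i ≤ n + 1, x i = z i} =
      M {x | ∀ i ≤ n, x i = z i} * K (z n) (z (n + 1))) (k j : ℕ) :
    M (lastZeroSet k (k + j)) = M {x | x k = 0} * M (lastZeroSet 0 j) := by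
  set A : ℕ → ℕ → Set ℕ := fun k i => if i < k then univ else if i = k then {0} else {0}ᶜ with hA
  have hset : ∀ k j, lastZeroSet k (k + j) = {x | ∀ i ≤ k + j, x i ∈ A k i} := by
    intro k j
    ext x
    simp only [lastZeroSet, hA, mem_ofPred_eq]
    constructor
    · rintro ⟨h1, h2⟩ i hi
      split_ifs with h3 h4
      · trivial
      · rw [h4]; exact h1
      · exact h2 i (by omega) hi
    · intro h
      refine ⟨by simpa using h k (by omega), fun i h1 h2 => ?_⟩
      have := h i h2
      rwa [if_neg (by omega), if_neg (by omega)] at this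
  have hmass : ∀ j z, pathMass M (A k) (k + j) z = M {x | x k = 0} * pathMass M (A 0) j z := by
    intro j
    induction j with
    | zero =>
      intro z
      by_cases hz : z = 0
      · subst hz
        have h1 : pathMass M (A k) (k + 0) 0 = M {x | x k = 0} := by
          rw [pathMass]
          congr 1
          ext x
          simp only [hA, add_zero, mem_ofPred_eq, and_iff_right_iff_imp]
          intro hx i hi
          split_ifs with h1 h2
          · trivial
          · rw [h2]; exact hx
          · omega
        have h2 : pathMass M (A 0) 0 0 = M {x | x 0 = 0} := by
          rw [pathMass]
          congr 1
          ext x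
          simp +contextual [hA]
        rw [h1, h2, h0, mul_one]
      · rw [pathMass_of_notMem (A k) _ _ (by simp [hA, hz]),
          pathMass_of_notMem (A 0) _ _ (by simp [hA, hz]), mul_zero]
    | succ j ih =>
      intro z
      by_cases hz : z = 0
      · rw [pathMass_of_notMem (A k) _ _ (by simp [hA, hz]),
          pathMass_of_notMem (A 0) _ _ (by simp [hA, hz]), mul_zero]
      · rw [← add_assoc, pathMass_succ hK (A k) (k + j) z (by
            simp only [hA]; rw [if_neg (by omega), if_neg (by omega)]; exact hz),
          pathMass_succ hK (A 0) j z (by simp [hA, hz]), ← ENNReal.tsum_mul_left]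
        exact tsum_congr fun y => by rw [ih, mul_assoc]
  have h2 := hset 0 j
  rw [zero_add] at h2
  rw [hset, ← tsum_pathMass, h2, ← tsum_pathMass, ← ENNReal.tsum_mul_left]
  exact tsum_congr (hmass j)

/-- The renewal equation: decomposition at the last visit to `0` before time `n`. -/
theorem sum_measure_mul_lastZeroSet [IsProbabilityMeasure M] (h0 : M {x | x 0 = 0} = 1)
    (hK : ∀ (n : ℕ) (z : ℕ → ℕ), M {x | ∀ i ≤ n + 1, x i = z i} =
      M {x | ∀ i ≤ n, x i = z i} * K (z n) (z (n + 1))) (n : ℕ) :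
    ∑ k ∈ Finset.range (n + 1), M {x | x k = 0} * M (lastZeroSet 0 (n - k)) = 1 := by
  have h1 : ∀ k ∈ Finset.range (n + 1),
      M {x | x k = 0} * M (lastZeroSet 0 (n - k)) = M (lastZeroSet k n) := by
    intro k hk
    rw [← measure_lastZeroSet h0 hK, Nat.add_sub_cancel' (by
      have := Finset.mem_range.1 hk; omega)]
  rw [Finset.sum_congr rfl h1, ← measure_biUnion_finset]
  · refine le_antisymm prob_le_one (h0 ▸ measure_mono fun x hx => ?_)
    have hx : x 0 = 0 := hx
    have hne : ((Finset.range (n + 1)).filter fun i => x i = 0).Nonempty :=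
      ⟨0, by simp [hx]⟩
    have hmem := Finset.max'_mem _ hne
    set k := ((Finset.range (n + 1)).filter fun i => x i = 0).max' hne with hk
    rw [Finset.mem_filter] at hmem
    refine mem_biUnion hmem.1 ⟨hmem.2, fun i hi hin hxi => ?_⟩
    have := Finset.le_max' ((Finset.range (n + 1)).filter fun i => x i = 0) i (by
      simp [hxi]; omega)
    omega
  · intro a ha b hb hab
    refine Set.disjoint_left.2 fun x h1 h2 => ?_
    have ha := Finset.mem_range.1 ha
    have hb := Finset.mem_range.1 hb
    rcases lt_or_gt_of_ne hab with h | h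
    · exact h1.2 b h (by omega) h2.1
    · exact h2.2 a h (by omega) h1.1
  · exact fun k _ => measurableSet_lastZeroSet k n

end chain

/-- The first return time exceeds `n` if and only if there is no zero at the times `1, …, n`. -/
theorem lt_zeroAfter_stepPath_iff (z : ℕ → ℕ) {n : ℕ} (hn : 1 ≤ n) :
    (n : ℝ≥0∞) < zeroAfter 1 (stepPath z) ↔ ∀ i, 0 < i → i ≤ n → z i ≠ 0 := by
  constructor
  · intro h i hi hin hzi
    refine absurd h (not_lt.2 ?_)
    rcases Nat.lt_or_ge 1 i with h1 | h1
    · have hmem : (i : ℝ≥0∞) ∈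
          (fun s : ℝ≥0 => (s : ℝ≥0∞)) '' {s | 1 < s ∧ stepPath z s = 0} :=
        ⟨(i : ℝ≥0), ⟨by exact_mod_cast h1, by simp [stepPath, hzi]⟩, by simp⟩
      exact (sInf_le hmem).trans (by exact_mod_cast hin)
    · -- A zero at time `1` makes `(1, 2)` part of the set, whose infimum is `1`.
      obtain rfl : i = 1 := by omega
      refine le_trans (le_of_forall_gt fun a ha => ?_) (by exact_mod_cast hn : (1 : ℝ≥0∞) ≤ n)
      obtain ⟨b, hb1, hb2⟩ := exists_between (lt_min ha (by norm_num : (1 : ℝ≥0∞) < 2))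
      lift b to ℝ≥0 using (hb2.trans_le (min_le_right _ _)).ne_top
      have hb2' := hb2.trans_le (min_le_right _ _)
      have hb1' : (1 : ℝ≥0) < b := by exact_mod_cast hb1
      have hb3 : b < 2 := by exact_mod_cast hb2'
      refine lt_of_le_of_lt (sInf_le (a := (b : ℝ≥0∞)) ⟨b, ⟨hb1', ?_⟩, rfl⟩)
        (hb2.trans_le (min_le_left _ _))
      have : ⌊b⌋₊ = 1 := by
        rw [Nat.floor_eq_iff (by positivity)]
        constructor
        · simpa using hb1'.le
        · norm_num; exact hb3
      simp [stepPath, this, hzi]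
  · intro h
    have h1 : ((n + 1 : ℕ) : ℝ≥0∞) ≤ zeroAfter 1 (stepPath z) := by
      refine le_sInf ?_
      rintro _ ⟨s, ⟨hs, hzs⟩, rfl⟩
      have hfl : 1 ≤ ⌊s⌋₊ := (Nat.one_le_floor_iff s).2 hs.le
      have : n + 1 ≤ ⌊s⌋₊ := by
        by_contra hcon
        exact h _ hfl (by omega) hzs
      have h2 : ((n + 1 : ℕ) : ℝ≥0) ≤ s := (Nat.cast_le.2 this).trans (Nat.floor_le (by positivity))
      simpa using (ENNReal.coe_le_coe.2 h2)
    exact lt_of_lt_of_le (by exact_mod_cast Nat.lt_succ_self n) h1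

/-! ### Generating functions on the unit interval -/

theorem summable_pow_mul_toReal (p : PMF ℕ) {s : ℝ} (hs : s ∈ Icc (0 : ℝ) 1) :
    Summable fun n => s ^ n * (p n).toReal := by
  have hp : Summable fun n => (p n).toReal :=
    ENNReal.summable_toReal (by rw [p.tsum_coe]; exact ENNReal.one_ne_top)
  refine Summable.of_nonneg_of_le (fun n => ?_) (fun n => ?_) hp
  · exact mul_nonneg (pow_nonneg hs.1 n) ENNReal.toReal_nonneg
  · exact mul_le_of_le_one_left ENNReal.toReal_nonneg (pow_le_one₀ hs.1 hs.2)

theorem genFun_one (p : PMF ℕ) : genFun p 1 = 1 := by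
  simp only [genFun, one_pow, one_mul]
  rw [← ENNReal.tsum_toReal_eq fun n => p.apply_ne_top n, p.tsum_coe]
  rfl

theorem genFun_mono (p : PMF ℕ) : MonotoneOn (genFun p) (Icc 0 1) := by
  intro s hs t ht hst
  refine (summable_pow_mul_toReal p hs).tsum_le_tsum (fun n => ?_) (summable_pow_mul_toReal p ht)
  exact mul_le_mul_of_nonneg_right (pow_le_pow_left₀ hs.1 hst n) ENNReal.toReal_nonneg

theorem apply_zero_le_genFun (p : PMF ℕ) {s : ℝ} (hs : s ∈ Icc (0 : ℝ) 1) :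
    (p 0).toReal ≤ genFun p s := by
  simpa [genFun] using (summable_pow_mul_toReal p hs).le_tsum 0 fun n _ =>
    mul_nonneg (pow_nonneg hs.1 n) ENNReal.toReal_nonneg

theorem genFun_mem_Icc (p : PMF ℕ) {s : ℝ} (hs : s ∈ Icc (0 : ℝ) 1) :
    genFun p s ∈ Icc (0 : ℝ) 1 :=
  ⟨ENNReal.toReal_nonneg.trans (apply_zero_le_genFun p hs),
    (genFun_mono p hs ⟨zero_le_one, le_rfl⟩ hs.2).trans_eq (genFun_one p)⟩

theorem convexOn_genFun (p : PMF ℕ) : ConvexOn ℝ (Icc 0 1) (genFun p) := by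
  refine ⟨convex_Icc 0 1, fun s hs t ht a b ha hb hab => ?_⟩
  have hst := convex_Icc (0 : ℝ) 1 hs ht ha hb hab
  simp only [smul_eq_mul, genFun, ← tsum_mul_left] at hst ⊢
  rw [← ((summable_pow_mul_toReal p hs).mul_left a).tsum_add
    ((summable_pow_mul_toReal p ht).mul_left b)]
  refine (summable_pow_mul_toReal p hst).tsum_le_tsum (fun n => ?_)
    (((summable_pow_mul_toReal p hs).mul_left a).add ((summable_pow_mul_toReal p ht).mul_left b))
  have := (convexOn_pow (𝕜 := ℝ) n).2 hs.1 ht.1 ha hb hab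
  simp only [smul_eq_mul] at this
  nlinarith [mul_le_mul_of_nonneg_right this (ENNReal.toReal_nonneg (a := p n))]

theorem ofReal_genFun (p : PMF ℕ) {s : ℝ} (hs : s ∈ Icc (0 : ℝ) 1) :
    p.egenFun (ENNReal.ofReal s) = ENNReal.ofReal (genFun p s) := by
  rw [genFun, ENNReal.ofReal_tsum_of_nonneg
    (fun n => mul_nonneg (pow_nonneg hs.1 n) ENNReal.toReal_nonneg)
    (summable_pow_mul_toReal p hs), PMF.egenFun]
  refine tsum_congr fun n => ?_
  rw [ENNReal.ofReal_mul (pow_nonneg hs.1 n), ENNReal.ofReal_toReal (p.apply_ne_top n),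
    ENNReal.ofReal_pow hs.1, mul_comm]

theorem iterate_genFun_mem_Icc (p : PMF ℕ) (n : ℕ) : (genFun p)^[n] 0 ∈ Icc (0 : ℝ) 1 := by
  induction n with
  | zero => simp
  | succ n ih =>
    rw [Function.iterate_succ_apply']
    exact genFun_mem_Icc p ih

theorem iterate_egenFun_zero (p : PMF ℕ) (n : ℕ) :
    p.egenFun^[n] 0 = ENNReal.ofReal ((genFun p)^[n] 0) := by
  induction n with
  | zero => simp
  | succ n ih =>
    rw [Function.iterate_succ_apply', Function.iterate_succ_apply', ih,
      ofReal_genFun p (iterate_genFun_mem_Icc p n)]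

/-! ### Iteration of a regularly varying map -/

/-- If `u ↦ u * A u` is convex and `A` is regularly varying at `0` with index `α`, the iterates
`q (n + 1) = q n * (1 - A (q n))` satisfy `A (q n) ∼ 1 / (α n)`. By convexity the slope of
`u * A u` between `q (n + 1)` and `q n` is `(1 + α + o(1)) * A (q n)`, hence the increments of
`1 / A (q n)` tend to `α`. -/
theorem tendsto_nat_mul_of_iterate {A : ℝ → ℝ} {q : ℕ → ℝ} {α : ℝ} (hα : 0 < α)
    (hconv : ConvexOn ℝ (Icc 0 1) fun u => u * A u)
    (hreg : ∀ a : ℝ, 0 < a → Tendsto (fun u => A (a * u) / A u) (𝓝[>] 0) (𝓝 (a ^ α)))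
    (hq : ∀ n, q n ∈ Ioc (0 : ℝ) 1) (hq0 : Tendsto q atTop (𝓝 0))
    (hstep : ∀ n, q (n + 1) = q n * (1 - A (q n))) (hApos : ∀ n, 0 < A (q n))
    (hA0 : Tendsto (fun n => A (q n)) atTop (𝓝 0)) :
    Tendsto (fun n : ℕ => (n : ℝ) * A (q n)) atTop (𝓝 (1 / α)) := by
  have hA1 : ∀ n, A (q n) < 1 := by
    intro n
    have h1 := (hq (n + 1)).1
    rw [hstep] at h1
    have := pos_of_mul_pos_right h1 (hq n).1.le
    linarith
  set ρ : ℕ → ℝ := fun n =>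
    (q (n + 1) * A (q (n + 1)) - q n * A (q n)) / (q (n + 1) - q n) / A (q n) with hρdef
  have hlt : ∀ n, q (n + 1) < q n := by
    intro n
    rw [hstep]
    nlinarith [mul_pos (hq n).1 (hApos n)]
  have hqgt : Tendsto q atTop (𝓝[>] 0) :=
    tendsto_nhdsWithin_iff.2 ⟨hq0, Eventually.of_forall fun n => (hq n).1⟩
  -- the slope between `q n` and `b * q n`, relative to `A (q n)`
  have hslope : ∀ b : ℝ, 0 < b → b ≠ 1 → Tendsto (fun n =>
      (b * q n * A (b * q n) - q n * A (q n)) / (b * q n - q n) / A (q n)) atTop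
      (𝓝 ((b ^ (1 + α) - 1) / (b - 1))) := by
    intro b hb hb1
    have h := ((((hreg b hb).comp hqgt).const_mul b).sub_const 1).div_const (b - 1)
    rw [Real.rpow_add hb, Real.rpow_one]
    refine h.congr fun n => ?_
    have h1 := (hq n).1.ne'
    have h2 := (hApos n).ne'
    have h3 : b - 1 ≠ 0 := sub_ne_zero.2 hb1
    have h4 : b * q n - q n ≠ 0 := by
      rw [show b * q n - q n = (b - 1) * q n by ring]
      exact mul_ne_zero h3 h1
    simp only [Function.comp]
    rw [show b * q n - q n = (b - 1) * q n by ring] at *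
    field_simp
  have hder : Tendsto (fun b : ℝ => (b ^ (1 + α) - 1) / (b - 1)) (𝓝[≠] 1) (𝓝 (1 + α)) := by
    have h := (Real.hasDerivAt_rpow_const (x := 1) (p := 1 + α) (Or.inl one_ne_zero))
    rw [hasDerivAt_iff_tendsto_slope] at h
    simp only [Real.one_rpow, mul_one] at h
    refine h.congr fun b => ?_
    rw [slope_def_field, Real.one_rpow]
  have hρ : Tendsto ρ atTop (𝓝 (1 + α)) := by
    rw [tendsto_order]
    constructor
    · intro l hl
      have h1 := (hder.mono_left (nhdsWithin_mono 1
        fun x (hx : x ∈ Iio 1) => (mem_Iio.1 hx).ne)).eventually (lt_mem_nhds hl)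
      have h2 : ∀ᶠ b : ℝ in 𝓝[<] 1, 0 < b :=
        nhdsWithin_le_nhds (lt_mem_nhds one_pos)
      obtain ⟨b, hb1, hb2, hb3⟩ := (h1.and (h2.and self_mem_nhdsWithin)).exists
      have hb3 : b < 1 := hb3
      filter_upwards [(hslope b hb2 hb3.ne).eventually (lt_mem_nhds hb1),
        hA0.eventually (gt_mem_nhds (sub_pos.2 hb3))] with n hn1 hn2
      refine hn1.trans_le (div_le_div_of_nonneg_right ?_ (hApos n).le)
      have hqn := hq n
      refine hconv.secant_mono (Ioc_subset_Icc_self (hq n)) ⟨mul_nonneg hb2.le hqn.1.le, ?_⟩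
        (Ioc_subset_Icc_self (hq (n + 1))) ?_ (hlt n).ne ?_
      · nlinarith [hqn.1, hqn.2]
      · nlinarith [hqn.1]
      · rw [hstep]; nlinarith [hqn.1]
    · intro l hl
      have h1 := (hder.mono_left (nhdsWithin_mono 1
        fun x (hx : x ∈ Ioi 1) => (mem_Ioi.1 hx).ne')).eventually (gt_mem_nhds hl)
      obtain ⟨b, hb1, hb3⟩ := (h1.and self_mem_nhdsWithin).exists
      have hb3 : 1 < b := hb3
      have hb2 : 0 < b := by linarith
      have hbq : ∀ᶠ n in atTop, b * q n < 1 :=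
        (by simpa using hq0.const_mul b : Tendsto (fun n => b * q n) atTop (𝓝 0)).eventually
          (gt_mem_nhds one_pos)
      filter_upwards [(hslope b hb2 hb3.ne').eventually (gt_mem_nhds hb1), hbq] with n hn1 hn2
      refine lt_of_le_of_lt (div_le_div_of_nonneg_right ?_ (hApos n).le) hn1
      have hqn := hq n
      refine hconv.secant_mono (Ioc_subset_Icc_self (hq n)) (Ioc_subset_Icc_self (hq (n + 1)))
        ⟨by nlinarith [hqn.1], hn2.le⟩ (hlt n).ne ?_ ?_
      · nlinarith [hqn.1]
      · nlinarith [hqn.1, hlt n]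
  have hincr : Tendsto (fun n => (A (q (n + 1)))⁻¹ - (A (q n))⁻¹) atTop (𝓝 α) := by
    have h1 : Tendsto (fun n => (ρ n - 1) / (1 - ρ n * A (q n))) atTop
        (𝓝 ((1 + α - 1) / (1 - (1 + α) * 0))) :=
      (hρ.sub_const 1).div ((hρ.mul hA0).const_sub 1) (by simp)
    rw [show (1 + α - 1) / (1 - (1 + α) * 0) = α by simp] at h1
    refine h1.congr fun n => ?_
    have hqn := (hq n).1
    have ha := hApos n
    have ha1 := hA1 n
    have ha' := hApos (n + 1)
    have hd : q (n + 1) - q n = - (q n * A (q n)) := by rw [hstep]; ring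
    have hρn : ρ n * A (q n) * A (q n) = A (q n) - (1 - A (q n)) * A (q (n + 1)) := by
      simp only [hρdef]
      rw [hd]
      rw [show q (n + 1) * A (q (n + 1)) = q n * ((1 - A (q n)) * A (q (n + 1))) by
        rw [← mul_assoc, ← hstep]]
      field_simp
      ring
    have h2 : 1 - ρ n * A (q n) = (1 - A (q n)) * A (q (n + 1)) / A (q n) := by
      field_simp
      linarith
    have h3 : ρ n = (A (q n) - (1 - A (q n)) * A (q (n + 1))) / (A (q n) * A (q n)) := by
      field_simp
      linarith
    rw [h2, h3]
    have h4 : (1 - A (q n)) ≠ 0 := by linarith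
    field_simp
    ring
  have hces := hincr.cesaro
  have ht : Tendsto (fun n : ℕ => (n : ℝ)⁻¹ * (A (q n))⁻¹) atTop (𝓝 α) := by
    have h0 : Tendsto (fun n : ℕ => (n : ℝ)⁻¹ * (A (q 0))⁻¹) atTop (𝓝 0) := by
      simpa using (tendsto_inv_atTop_nhds_zero_nat (𝕜 := ℝ)).mul_const (A (q 0))⁻¹
    have := hces.add h0
    rw [add_zero] at this
    refine this.congr fun n => ?_
    rw [Finset.sum_range_sub (fun n => (A (q n))⁻¹)]
    ring
  have := ht.inv₀ hα.ne'
  rw [one_div]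
  refine this.congr fun n => ?_
  rw [mul_inv, inv_inv, inv_inv]

/-! ### The rate of convergence of the generating functions -/

/-- Under Assumption (SL) the factors `g (f_n 0)` are `1 - δ / n + o(1 / n)` with
`δ = d / (c α)`. -/
theorem AssumptionSL.tendsto_nat_mul {μ ν : PMF ℕ} {c d α : ℝ} (h : AssumptionSL μ ν c d α) :
    Tendsto (fun n : ℕ => (n : ℝ) * (1 - genFun ν ((genFun μ)^[n] 0))) atTop
      (𝓝 (d / (c * α))) := by
  obtain ⟨l, k, hl, hk, hlk, hf, hg⟩ := h.exists_slowlyVarying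
  have hc := h.c_pos
  have hd := h.d_pos
  have hα := h.α_pos
  set F := genFun μ with hF
  set A : ℝ → ℝ := fun u => 1 - (1 - F (1 - u)) / u with hA
  have hAeq : ∀ u ∈ Ioo (0 : ℝ) 1, A u = c * u ^ α * l u := by
    intro u hu
    have h1 := hf (1 - u) ⟨by linarith [hu.2], by linarith [hu.1]⟩
    rw [sub_sub_cancel] at h1
    simp only [hA]
    rw [h1, Real.rpow_add hu.1, Real.rpow_one]
    field_simp [hu.1.ne']
    ring
  have hmulA : ∀ u, u * A u = u - 1 + F (1 - u) := by
    intro u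
    rcases eq_or_ne u 0 with rfl | hu
    · simp [hF, genFun_one]
    · simp only [hA]; field_simp; ring
  have hmem : ∀ u ∈ Icc (0 : ℝ) 1, 1 - u ∈ Icc (0 : ℝ) 1 := fun u hu =>
    ⟨by linarith [hu.2], by linarith [hu.1]⟩
  -- At `u = 0` the junk value of the division is harmless: `u * A u = 0 = f 1 - 1`.
  have hconv : ConvexOn ℝ (Icc 0 1) fun u => u * A u := by
    simp only [hmulA]
    refine ⟨convex_Icc 0 1, fun s hs t ht a b ha hb hab => ?_⟩
    have := (convexOn_genFun μ).2 (hmem s hs) (hmem t ht) ha hb hab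
    simp only [smul_eq_mul] at this ⊢
    rw [show a * (1 - s) + b * (1 - t) = 1 - (a * s + b * t) by linear_combination hab] at this
    simp only [hF]
    linear_combination this + hab
  have hmono : MonotoneOn A (Ioc 0 1) := by
    intro u hu v hv huv
    have := hconv.secant_mono (a := 0) ⟨le_rfl, zero_le_one⟩ (Ioc_subset_Icc_self hu)
      (Ioc_subset_Icc_self hv) hu.1.ne' hv.1.ne' huv
    simpa [hu.1.ne', hv.1.ne'] using this
  have hApos : ∀ u ∈ Ioc (0 : ℝ) 1, 0 < A u := by
    intro u hu
    have h2 : u / 2 ∈ Ioo (0 : ℝ) 1 := ⟨by linarith [hu.1], by linarith [hu.2]⟩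
    refine lt_of_lt_of_le ?_ (hmono (Ioo_subset_Ioc_self h2) hu (by linarith [hu.1]))
    rw [hAeq _ h2]
    exact mul_pos (mul_pos hc (Real.rpow_pos_of_pos h2.1 _)) (hl.pos _ h2)
  have hev : ∀ a : ℝ, 0 < a → ∀ᶠ u : ℝ in 𝓝[>] 0, a * u ∈ Ioo (0 : ℝ) 1 := by
    intro a ha
    filter_upwards [Ioo_mem_nhdsGT (inv_pos.2 ha)] with u hu
    refine ⟨mul_pos ha hu.1, ?_⟩
    calc a * u < a * a⁻¹ := mul_lt_mul_of_pos_left hu.2 ha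
      _ = 1 := mul_inv_cancel₀ ha.ne'
  have hreg : ∀ a : ℝ, 0 < a → Tendsto (fun u => A (a * u) / A u) (𝓝[>] 0) (𝓝 (a ^ α)) := by
    intro a ha
    have h1 := (hl.tendsto_div a ha).const_mul (a ^ α)
    rw [mul_one] at h1
    refine h1.congr' ?_
    filter_upwards [hev a ha, hev 1 one_pos] with u hu1 hu2
    rw [one_mul] at hu2
    rw [hAeq _ hu1, hAeq _ hu2, Real.mul_rpow ha.le hu2.1.le]
    have h3 := (Real.rpow_pos_of_pos hu2.1 α).ne'
    have h4 := (hl.pos u hu2).ne'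
    field_simp
  have hAlim : Tendsto A (𝓝[>] 0) (𝓝 0) := by
    have hm : MonotoneOn A (Ioo 0 1) := hmono.mono Ioo_subset_Ioc_self
    have hbdd : BddBelow (A '' Ioo 0 1) :=
      ⟨0, by rintro _ ⟨u, hu, rfl⟩; exact (hApos u (Ioo_subset_Ioc_self hu)).le⟩
    have hL := hm.tendsto_nhdsWithin_Ioo_right (by simp) hbdd
    set L := sInf (A '' Ioo 0 1)
    by_cases hL0 : L = 0
    · rwa [hL0] at hL
    · -- A nonzero limit is incompatible with regular variation of index `α > 0`
      exfalso
      have h2 : Tendsto (fun u : ℝ => 2 * u) (𝓝[>] 0) (𝓝[>] 0) := by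
        refine tendsto_nhdsWithin_iff.2 ⟨?_, ?_⟩
        · have : Tendsto (fun u : ℝ => 2 * u) (𝓝 0) (𝓝 (2 * 0)) := tendsto_id.const_mul 2
          rw [mul_zero] at this
          exact this.mono_left nhdsWithin_le_nhds
        · filter_upwards [self_mem_nhdsWithin] with u (hu : 0 < u)
          exact mul_pos two_pos hu
      have h3 := (hL.comp h2).div hL hL0
      rw [div_self hL0] at h3
      have h4 := tendsto_nhds_unique (hreg 2 two_pos) h3
      have h5 := Real.one_lt_rpow (one_lt_two) hα
      linarith
  have hFle : ∀ u ∈ Icc (0 : ℝ) 1, F (1 - u) ≤ 1 := fun u hu => (genFun_mem_Icc μ (hmem u hu)).2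
  have hAlt : ∀ u ∈ Ioc (0 : ℝ) 1, A u < 1 := by
    intro u hu
    have hcl := Ioc_subset_Icc_self hu
    -- `f (1 - u) = 1` would force `A = 1` on `(0, u)`, against `A → 0`.
    suffices F (1 - u) < 1 by
      have : 0 < (1 - F (1 - u)) / u := div_pos (by linarith) hu.1
      simp only [hA]; linarith
    refine lt_of_le_of_ne (hFle u hcl) fun hcon => ?_
    have hone : ∀ᶠ v in 𝓝[>] 0, A v = 1 := by
      filter_upwards [Ioo_mem_nhdsGT hu.1] with v hv
      have hv' : v ∈ Icc (0 : ℝ) 1 := ⟨hv.1.le, hv.2.le.trans hu.2⟩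
      have h1 : F (1 - u) ≤ F (1 - v) :=
        genFun_mono μ (hmem u hcl) (hmem v hv') (by linarith [hv.2])
      have h2 : F (1 - v) = 1 := le_antisymm (hFle v hv') (by linarith)
      simp [hA, h2]
    exact zero_ne_one (tendsto_nhds_unique hAlim (tendsto_const_nhds.congr' (hone.mono
      fun v hv => hv.symm)))
  set q : ℕ → ℝ := fun n => 1 - F^[n] 0 with hq
  have hstep' : ∀ n, q (n + 1) = 1 - F (1 - q n) := by
    intro n
    simp only [hq, Function.iterate_succ_apply', sub_sub_cancel]
  have hstep : ∀ n, q (n + 1) = q n * (1 - A (q n)) := by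
    intro n
    rw [hstep', mul_sub, hmulA]
    ring
  have hqmem : ∀ n, q n ∈ Ioc (0 : ℝ) 1 := by
    intro n
    induction n with
    | zero => simp [hq]
    | succ n ih =>
      rw [hstep]
      have h1 := hAlt _ ih
      have h2 := hApos _ ih
      exact ⟨mul_pos ih.1 (by linarith), by nlinarith [ih.1, ih.2]⟩
  have hanti : Antitone q := antitone_nat_of_succ_le fun n => by
    rw [hstep]
    nlinarith [(hqmem n).1, hApos _ (hqmem n)]
  have hq0 : Tendsto q atTop (𝓝 0) := by
    have hbdd : BddBelow (range q) := ⟨0, by rintro _ ⟨n, rfl⟩; exact (hqmem n).1.le⟩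
    have hlim := tendsto_atTop_ciInf hanti hbdd
    set L := ⨅ n, q n
    have hLle : ∀ n, L ≤ q n := fun n => ciInf_le hbdd n
    have hL0 : 0 ≤ L := le_ciInf fun n => (hqmem n).1.le
    rcases hL0.eq_or_lt with hL | hL
    · rwa [← hL] at hlim
    · exfalso
      have hLmem : L ∈ Ioc (0 : ℝ) 1 := ⟨hL, (hLle 0).trans (hqmem 0).2⟩
      have hdiff := hlim.sub (hlim.comp (tendsto_add_atTop_nat 1))
      rw [sub_self] at hdiff
      have hlow : ∀ n, L * A L ≤ q n - (q ∘ fun n => n + 1) n := by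
        intro n
        simp only [Function.comp, hstep]
        have := mul_le_mul (hLle n) (hmono hLmem (hqmem n) (hLle n)) (hApos _ hLmem).le
          (hqmem n).1.le
        linarith
      have := ge_of_tendsto' hdiff hlow
      have := mul_pos hL (hApos _ hLmem)
      linarith
  have hqgt : Tendsto q atTop (𝓝[>] 0) :=
    tendsto_nhdsWithin_iff.2 ⟨hq0, Eventually.of_forall fun n => (hqmem n).1⟩
  have hmain := tendsto_nat_mul_of_iterate hα hconv hreg hqmem hq0 hstep
    (fun n => hApos _ (hqmem n)) (hAlim.comp hqgt)
  have hkl : Tendsto (fun n => (l (q n) / k (q n))⁻¹) atTop (𝓝 1) := by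
    simpa using (hlk.comp hqgt).inv₀ one_ne_zero
  have := (hmain.const_mul (d / c)).mul hkl
  rw [show d / c * (1 / α) * 1 = d / (c * α) by field_simp] at this
  refine this.congr' ?_
  filter_upwards [eventually_ge_atTop 1] with n hn
  obtain ⟨m, rfl⟩ : ∃ m, n = m + 1 := ⟨n - 1, by omega⟩
  have hm := hqmem m
  have hlt : q (m + 1) ∈ Ioo (0 : ℝ) 1 := by
    refine ⟨(hqmem _).1, ?_⟩
    rw [hstep]
    nlinarith [hm.1, hm.2, hApos _ hm, mul_pos hm.1 (hApos _ hm)]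
  have h1 : F^[m + 1] 0 = 1 - q (m + 1) := by simp only [hq]; ring
  have h2 := hg (1 - q (m + 1)) ⟨by linarith [hlt.2], by linarith [hlt.1]⟩
  rw [h1, h2, sub_sub_cancel, hAeq _ hlt]
  have h3 := (hl.pos _ hlt).ne'
  have h4 := (hk.pos _ hlt).ne'
  field_simp
  ring_nf

/-! ### Regularly varying sequences -/

/-- A positive sequence with `u (n + 1) / u n = 1 - δ / n + o(1 / n)` is regularly varying with
index `-δ`: the increments of `log (u n) + δ log n` are `o(1 / n)`, so that this sequence changes
by `o(1)` between indices of bounded ratio. -/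
theorem tendsto_div_of_tendsto_nat_mul {ι : Type*} {F : Filter ι} {u : ℕ → ℝ} {δ a : ℝ}
    (hpos : ∀ n, 0 < u n)
    (hlim : Tendsto (fun n : ℕ => (n : ℝ) * (1 - u (n + 1) / u n)) atTop (𝓝 δ)) (ha : 0 < a)
    {m n : ι → ℕ} (hm : Tendsto m F atTop) (hn : Tendsto n F atTop)
    (hmn : Tendsto (fun i => (m i : ℝ) / n i) F (𝓝 a)) :
    Tendsto (fun i => u (m i) / u (n i)) F (𝓝 (a ^ (-δ))) := by
  set v : ℕ → ℝ := fun n => Real.log (u n) + δ * Real.log n with hv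
  have hincr : Tendsto (fun n : ℕ => (n : ℝ) * (v (n + 1) - v n)) atTop (𝓝 0) := by
    have h1 : Tendsto (fun n : ℕ => (n : ℝ) * Real.log (1 + (u (n + 1) / u n - 1))) atTop
        (𝓝 (-δ)) :=
      Real.tendsto_nat_mul_log_one_add_of_tendsto (hlim.neg.congr fun n => by ring)
    have h2 : Tendsto (fun n : ℕ => (n : ℝ) * Real.log (1 + (n : ℝ)⁻¹)) atTop (𝓝 1) := by
      refine Real.tendsto_nat_mul_log_one_add_of_tendsto (tendsto_const_nhds.congr' ?_)
      filter_upwards [eventually_gt_atTop 0] with n hn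
      have : (n : ℝ) ≠ 0 := by positivity
      field_simp
    have h3 := h1.add (h2.const_mul δ)
    rw [mul_one, neg_add_cancel] at h3
    refine h3.congr' ?_
    filter_upwards [eventually_gt_atTop 0] with n hn
    have hn' : (n : ℝ) ≠ 0 := by positivity
    have h4 : 1 + (n : ℝ)⁻¹ = (n + 1 : ℝ) / n := by field_simp
    rw [add_sub_cancel, h4, Real.log_div (hpos _).ne' (hpos _).ne',
      Real.log_div (by positivity) hn']
    simp only [hv]
    push_cast
    ring
  -- the oscillation of `v` between `n` and `m`
  have hosc : ∀ ε > 0, ∃ n₀, ∀ n m : ℕ, n₀ < n → n ≤ m →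
      |v m - v n| ≤ ε * ((m : ℝ) / n) := by
    intro ε hε
    obtain ⟨n₀, hn₀⟩ := (Metric.tendsto_atTop.1 hincr) ε hε
    refine ⟨n₀, fun n m hn hnm => ?_⟩
    have hn0 : (0 : ℝ) < n := by exact_mod_cast (Nat.zero_le n₀).trans_lt hn
    have hstep : ∀ j ∈ Finset.Ico n m, |v (j + 1) - v j| ≤ ε / n := by
      intro j hj
      have hj1 := (Finset.mem_Ico.1 hj).1
      have h := hn₀ j (by omega)
      rw [Real.dist_eq, sub_zero, abs_mul, Nat.abs_cast] at h
      rw [le_div_iff₀ hn0]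
      have : (n : ℝ) ≤ j := by exact_mod_cast hj1
      nlinarith [abs_nonneg (v (j + 1) - v j)]
    rw [← Finset.sum_Ico_sub v hnm]
    refine (Finset.abs_sum_le_sum_abs _ _).trans ((Finset.sum_le_card_nsmul _ _ _ hstep).trans ?_)
    rw [Nat.card_Ico, nsmul_eq_mul, Nat.cast_sub hnm]
    rw [mul_div_assoc', mul_div_assoc', mul_comm]
    gcongr
    linarith
  have hinv : Tendsto (fun i => (n i : ℝ) / m i) F (𝓝 a⁻¹) := by
    simpa using hmn.inv₀ ha.ne'
  have hv0 : Tendsto (fun i => v (m i) - v (n i)) F (𝓝 0) := by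
    rw [Metric.tendsto_nhds]
    intro ε hε
    set B := a + a⁻¹ + 1 with hB
    have hB0 : 0 < B := by positivity
    obtain ⟨n₀, hn₀⟩ := hosc (ε / (2 * B)) (by positivity)
    filter_upwards [hm.eventually_gt_atTop n₀, hn.eventually_gt_atTop n₀,
      hmn.eventually (gt_mem_nhds (show a < B by
        rw [hB]; linarith [inv_pos.2 ha])),
      hinv.eventually (gt_mem_nhds (show a⁻¹ < B by rw [hB]; linarith))] with i h1 h2 h3 h4
    have hlt : ε / (2 * B) * B < ε := by
      have : ε / (2 * B) * B = ε / 2 := by field_simp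
      linarith
    rw [Real.dist_eq, sub_zero]
    refine lt_of_le_of_lt ?_ hlt
    rcases le_total (n i) (m i) with h | h
    · exact (hn₀ _ _ h2 h).trans (by gcongr)
    · rw [abs_sub_comm]
      exact (hn₀ _ _ h1 h).trans (by gcongr)
  have hexp := ((Real.continuous_exp.tendsto 0).comp hv0).mul
    (hmn.rpow_const (p := -δ) (Or.inl ha.ne'))
  rw [Real.exp_zero, one_mul] at hexp
  refine hexp.congr' ?_
  filter_upwards [hm.eventually_gt_atTop 0, hn.eventually_gt_atTop 0] with i h1 h2
  have h1' : (0 : ℝ) < m i := by exact_mod_cast h1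
  have h2' : (0 : ℝ) < n i := by exact_mod_cast h2
  rw [Function.comp, Real.rpow_def_of_pos (by positivity), ← Real.exp_add,
    Real.log_div h1'.ne' h2'.ne']
  have : v (m i) - v (n i) + (Real.log (m i) - Real.log (n i)) * -δ =
      Real.log (u (m i)) - Real.log (u (n i)) := by
    simp only [hv]; ring
  rw [this, Real.exp_sub, Real.exp_log (hpos _), Real.exp_log (hpos _)]

/-- The slowly varying function attached to a sequence that is regularly varying with index
`-δ`. -/
theorem slowlyVarying_floor_mul_rpow {u : ℕ → ℝ} {δ : ℝ} (hpos : ∀ n, 0 < u n)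
    (hlim : Tendsto (fun n : ℕ => (n : ℝ) * (1 - u (n + 1) / u n)) atTop (𝓝 δ)) :
    SlowlyVaryingAtInfinity fun x => u ⌊x⌋₊ * (x + 1) ^ δ where
  pos x hx := mul_pos (hpos _) (Real.rpow_pos_of_pos (by linarith [mem_Ici.1 hx]) _)
  measurable := by
    have : Measurable fun x : ℝ => u ⌊x⌋₊ * (x + 1) ^ δ :=
      ((measurable_from_nat (f := u)).comp Nat.measurable_floor).mul
        ((measurable_id.add_const 1).pow_const δ)
    exact this.comp measurable_subtype_coe
  tendsto_div a ha := by
    have hax : Tendsto (fun x : ℝ => a * x) atTop atTop := tendsto_id.const_mul_atTop ha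
    have h1 : Tendsto (fun x : ℝ => u ⌊a * x⌋₊ / u ⌊x⌋₊) atTop (𝓝 (a ^ (-δ))) := by
      refine tendsto_div_of_tendsto_nat_mul hpos hlim ha (tendsto_nat_floor_atTop.comp hax)
        tendsto_nat_floor_atTop ?_
      have h := (tendsto_nat_floor_mul_div_atTop ha.le).div
        (tendsto_nat_floor_mul_div_atTop (zero_le_one' ℝ)) one_ne_zero
      rw [div_one] at h
      refine h.congr' ?_
      filter_upwards [eventually_ge_atTop 1] with x hx
      have h2 : x ≠ 0 := by linarith
      simp only [one_mul, Pi.div_apply]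
      rw [div_div_div_cancel_right₀ h2]
    have h2 : Tendsto (fun x : ℝ => (a * x + 1) / (x + 1)) atTop (𝓝 a) := by
      have h : Tendsto (fun x : ℝ => a + (1 - a) * (x + 1)⁻¹) atTop (𝓝 (a + (1 - a) * 0)) :=
        ((tendsto_inv_atTop_zero.comp (tendsto_atTop_add_const_right _ 1 tendsto_id)).const_mul
          _).const_add a
      rw [mul_zero, add_zero] at h
      refine h.congr' ?_
      filter_upwards [eventually_ge_atTop 0] with x hx
      have : x + 1 ≠ 0 := by positivity
      field_simp
      ring
    have h3 := h1.mul (h2.rpow_const (p := δ) (Or.inl ha.ne'))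
    rw [← Real.rpow_add ha, neg_add_cancel, Real.rpow_zero] at h3
    refine h3.congr' ?_
    filter_upwards [eventually_ge_atTop 0] with x hx
    rw [Real.div_rpow (by positivity) (by positivity)]
    rw [div_mul_div_comm]

/-- A Potter bound: a regularly varying sequence of index `-δ` decreases at most as fast as
`n ^ (-β)` when `β > δ`. -/
theorem exists_rpow_mul_le {u : ℕ → ℝ} {δ β : ℝ} (hpos : ∀ n, 0 < u n) (hanti : Antitone u)
    (hlim : Tendsto (fun n : ℕ => (n : ℝ) * (1 - u (n + 1) / u n)) atTop (𝓝 δ))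
    (hδβ : δ < β) (hβ0 : 0 ≤ β) (hβ1 : β ≤ 1) :
    ∃ C > 0, ∀ m n : ℕ, m ≤ n → ((m : ℝ) + 1) ^ β * u m ≤ C * (((n : ℝ) + 1) ^ β * u n) := by
  have h1 : Tendsto (fun n : ℕ => ((n : ℝ) + 2) * (1 - u (n + 1) / u n)) atTop (𝓝 δ) := by
    have h2 : Tendsto (fun n : ℕ => 1 + 2 * (n : ℝ)⁻¹) atTop (𝓝 (1 + 2 * 0)) :=
      ((tendsto_inv_atTop_nhds_zero_nat (𝕜 := ℝ)).const_mul 2).const_add 1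
    rw [mul_zero, add_zero] at h2
    have h3 := h2.mul hlim
    rw [one_mul] at h3
    refine h3.congr' ?_
    filter_upwards [eventually_gt_atTop 0] with n hn
    have : (n : ℝ) ≠ 0 := by positivity
    field_simp
  obtain ⟨n₀, hn₀⟩ := eventually_atTop.1 (h1.eventually (gt_mem_nhds hδβ))
  -- Bernoulli's inequality makes `(n + 1) ^ β * u n` eventually nondecreasing.
  have hstep : ∀ n, n₀ ≤ n → ((n : ℝ) + 1) ^ β * u n ≤ (((n + 1 : ℕ) : ℝ) + 1) ^ β * u (n + 1) := by
    intro n hn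
    have h2 := hn₀ n hn
    have hn2 : (0 : ℝ) < (n : ℝ) + 2 := by positivity
    have h3 : (((n : ℝ) + 1) / (n + 2)) ^ β ≤ u (n + 1) / u n := by
      have h4 : ((n : ℝ) + 1) / (n + 2) = 1 + -(1 / ((n : ℝ) + 2)) := by field_simp; ring
      have h5 : (1 : ℝ) / ((n : ℝ) + 2) ≤ 1 := by
        rw [div_le_one hn2]; linarith [(Nat.cast_nonneg n : (0 : ℝ) ≤ n)]
      have h6 := rpow_one_add_le_one_add_mul_self (s := -(1 / ((n : ℝ) + 2))) (by linarith)
        hβ0 hβ1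
      rw [h4]
      refine h6.trans ?_
      have h7 : 1 - u (n + 1) / u n ≤ β * (1 / ((n : ℝ) + 2)) := by
        rw [mul_one_div, le_div_iff₀ hn2]; linarith
      linarith
    rw [Real.div_rpow (by positivity) hn2.le, div_le_div_iff₀ (by positivity) (hpos n)] at h3
    push_cast
    rw [show (n : ℝ) + 1 + 1 = n + 2 by ring]
    linarith
  have hmono : ∀ m n, n₀ ≤ m → m ≤ n →
      ((m : ℝ) + 1) ^ β * u m ≤ ((n : ℝ) + 1) ^ β * u n := by
    intro m n hm hmn
    induction n, hmn using Nat.le_induction with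
    | base => exact le_rfl
    | succ n hmn ih => exact ih.trans (hstep n (hm.trans hmn))
  -- The factor `u 0 / u n₀` absorbs the finitely many terms before `n₀`.
  refine ⟨u 0 / u n₀, div_pos (hpos 0) (hpos n₀), fun m n hmn => ?_⟩
  have hone : 1 ≤ u 0 / u n₀ := (one_le_div (hpos n₀)).2 (hanti (Nat.zero_le _))
  have hnn : 0 ≤ ((n : ℝ) + 1) ^ β * u n := mul_nonneg (by positivity) (hpos n).le
  rcases le_total n₀ m with h | h
  · exact (hmono m n h hmn).trans (le_mul_of_one_le_left hnn hone)
  · rcases le_total n₀ n with h' | h'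
    · calc ((m : ℝ) + 1) ^ β * u m ≤ ((n₀ : ℝ) + 1) ^ β * u 0 := by
            gcongr
            · exact (hpos m).le
            · exact hanti (Nat.zero_le m)
        _ = u 0 / u n₀ * (((n₀ : ℝ) + 1) ^ β * u n₀) := by
            field_simp [(hpos n₀).ne']
        _ ≤ u 0 / u n₀ * (((n : ℝ) + 1) ^ β * u n) :=
            mul_le_mul_of_nonneg_left (hmono n₀ n le_rfl h') (zero_le_one.trans hone)
    · calc ((m : ℝ) + 1) ^ β * u m ≤ ((n : ℝ) + 1) ^ β * u 0 := by
            gcongr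
            · exact (hpos m).le
            · exact hanti (Nat.zero_le m)
        _ = u 0 / u n₀ * (((n : ℝ) + 1) ^ β * u n₀) := by
            field_simp [(hpos n₀).ne']
        _ ≤ u 0 / u n₀ * (((n : ℝ) + 1) ^ β * u n) := by
            gcongr
            exact hanti h'

/-! ### An Abelian theorem -/

/-- The integral of a step function over the half line. -/
theorem integral_comp_floor {h : ℕ → ℝ} (hsum : Summable fun n => ‖h n‖) :
    ∫ x in Ioi (0 : ℝ), h ⌊x⌋₊ = ∑' n, h n := by
  have hU : (⋃ n : ℕ, Ico (n : ℝ) (n + 1)) = Ici 0 := by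
    ext x
    simp only [mem_iUnion, mem_Ico, mem_Ici]
    constructor
    · rintro ⟨n, hn, _⟩; exact (Nat.cast_nonneg n).trans hn
    · intro hx; exact ⟨⌊x⌋₊, Nat.floor_le hx, Nat.lt_floor_add_one x⟩
  have heq : ∀ n : ℕ, EqOn (fun x : ℝ => h ⌊x⌋₊) (fun _ => h n) (Ico (n : ℝ) (n + 1)) := by
    intro n x hx
    simp only
    rw [Nat.floor_eq_on_Ico n x hx]
  have hvol : ∀ n : ℕ, volume.real (Ico (n : ℝ) (n + 1)) = 1 := by
    intro n; simp
  have hint : ∀ n : ℕ, IntegrableOn (fun x : ℝ => h ⌊x⌋₊) (Ico (n : ℝ) (n + 1)) := by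
    intro n
    rw [integrableOn_congr_fun (heq n) measurableSet_Ico]
    exact integrableOn_const (by simp)
  have hIon : IntegrableOn (fun x : ℝ => h ⌊x⌋₊) (⋃ n : ℕ, Ico (n : ℝ) (n + 1)) := by
    refine integrableOn_iUnion_of_summable_integral_norm hint (hsum.congr fun n => ?_)
    have : EqOn (fun x : ℝ => ‖h ⌊x⌋₊‖) (fun _ => ‖h n‖) (Ico (n : ℝ) (n + 1)) := fun x hx => by
      simp only; rw [Nat.floor_eq_on_Ico n x hx]
    rw [setIntegral_congr_fun measurableSet_Ico this, setIntegral_const, hvol, one_smul]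
  have hdisj : Pairwise (Function.onFun Disjoint fun n : ℕ => Ico (n : ℝ) (n + 1)) := by
    intro a b hab
    refine Set.disjoint_left.2 fun x ha hb => hab ?_
    rw [← Nat.floor_eq_on_Ico a x ha, Nat.floor_eq_on_Ico b x hb]
  have hs := hasSum_integral_iUnion (fun n : ℕ => measurableSet_Ico) hdisj hIon
  rw [hU, integral_Ici_eq_integral_Ioi] at hs
  rw [← hs.tsum_eq]
  refine tsum_congr fun n => ?_
  rw [setIntegral_congr_fun measurableSet_Ico (heq n), setIntegral_const, hvol, one_smul]

theorem summable_mul_exp_neg {r : ℕ → ℝ} {B s : ℝ} (h0 : ∀ n, 0 ≤ r n) (hB : ∀ n, r n ≤ B)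
    (hs : 0 < s) : Summable fun n : ℕ => r n * Real.exp (-(s * n)) := by
  have hgeom : Summable fun n : ℕ => B * Real.exp (-s) ^ n :=
    (summable_geometric_of_lt_one (Real.exp_pos _).le (by simpa using hs)).mul_left B
  refine Summable.of_nonneg_of_le (fun n => mul_nonneg (h0 n) (Real.exp_pos _).le)
    (fun n => ?_) hgeom
  rw [← Real.exp_nat_mul, show (n : ℝ) * -s = -(s * n) by ring]
  exact mul_le_mul_of_nonneg_right (hB n) (Real.exp_pos _).le

/-- The Abelian theorem for a nonincreasing sequence that is regularly varying with index
`-δ > -1`: dominated convergence in the Laplace transform, with the Potter bound as majorant. -/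
theorem tendsto_laplace_of_regularlyVarying {u : ℕ → ℝ} {δ : ℝ} (hpos : ∀ n, 0 < u n)
    (hanti : Antitone u)
    (hlim : Tendsto (fun n : ℕ => (n : ℝ) * (1 - u (n + 1) / u n)) atTop (𝓝 δ))
    (hδ0 : 0 ≤ δ) (hδ1 : δ < 1) {j : ℝ} (hj : 0 < j) :
    Tendsto (fun N : ℕ => (∑' n : ℕ, u n * Real.exp (-(j / N * n))) / (N * u N)) atTop
      (𝓝 ((1 / j) ^ (1 - δ) * Real.Gamma (1 - δ))) := by
  obtain ⟨β, hδβ, hβ1⟩ := exists_between hδ1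
  have hβ0 : 0 ≤ β := hδ0.trans hδβ.le
  obtain ⟨C, hC, hpot⟩ := exists_rpow_mul_le hpos hanti hlim hδβ hβ0 hβ1.le
  rw [← Real.integral_rpow_mul_exp_neg_mul_Ioi (by linarith) hj]
  set f : ℕ → ℝ → ℝ := fun N x => u ⌊(N : ℝ) * x⌋₊ / u N * Real.exp (-(j / N * ⌊(N : ℝ) * x⌋₊))
    with hf
  have hfi : ∀ᶠ N : ℕ in atTop,
      ∫ x in Ioi (0 : ℝ), f N x = (∑' n : ℕ, u n * Real.exp (-(j / N * n))) / (N * u N) := by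
    filter_upwards [eventually_gt_atTop 0] with N hN
    have hN' : (0 : ℝ) < N := by exact_mod_cast hN
    have hs := summable_mul_exp_neg (fun n => (hpos n).le) (fun n => hanti (Nat.zero_le n))
      (div_pos hj hN')
    have h1 := integral_comp_mul_left_Ioi
      (fun y : ℝ => u ⌊y⌋₊ / u N * Real.exp (-(j / N * ⌊y⌋₊))) 0 hN'
    rw [mul_zero, integral_comp_floor (h := fun n => u n / u N * Real.exp (-(j / N * n)))
      ((hs.div_const (u N)).norm.congr fun n => by rw [mul_div_right_comm])] at h1
    simp only [hf]
    rw [h1, smul_eq_mul]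
    simp only [div_mul_eq_mul_div]
    rw [tsum_div_const]
    field_simp
  refine Tendsto.congr' hfi ?_
  set bound : ℝ → ℝ := fun x => (C * 2 ^ β * x ^ (-β) + 1) * (Real.exp j * Real.exp (-j * x))
  refine tendsto_integral_filter_of_dominated_convergence bound ?_ ?_ ?_ ?_
  · refine Eventually.of_forall fun N => Measurable.aestronglyMeasurable ?_
    have hfl : Measurable fun x : ℝ => ⌊(N : ℝ) * x⌋₊ :=
      Nat.measurable_floor.comp (measurable_id.const_mul (N : ℝ))
    exact (measurable_from_nat (f := fun n => u n / u N * Real.exp (-(j / N * n)))).comp hfl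
  · filter_upwards [eventually_ge_atTop 1] with N hN
    refine (ae_restrict_iff' measurableSet_Ioi).2 (Eventually.of_forall fun x hx => ?_)
    have hx : 0 < x := hx
    have hN' : (1 : ℝ) ≤ N := by exact_mod_cast hN
    have hN0 : (0 : ℝ) < N := by linarith
    have hu : u ⌊(N : ℝ) * x⌋₊ / u N ≤ C * 2 ^ β * x ^ (-β) + 1 := by
      rcases le_total ⌊(N : ℝ) * x⌋₊ N with h | h
      · have h1 := hpot _ _ h
        have h2 : (N * x : ℝ) ^ β ≤ ((⌊(N : ℝ) * x⌋₊ : ℝ) + 1) ^ β :=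
          Real.rpow_le_rpow (by positivity) (Nat.lt_floor_add_one _).le hβ0
        have h3 : ((N : ℝ) + 1) ^ β ≤ (2 * N : ℝ) ^ β :=
          Real.rpow_le_rpow (by positivity) (by linarith) hβ0
        rw [Real.mul_rpow hN0.le hx.le] at h2
        rw [Real.mul_rpow two_pos.le hN0.le] at h3
        have h4 : (N : ℝ) ^ β * x ^ β * u ⌊(N : ℝ) * x⌋₊ ≤ C * (2 ^ β * (N : ℝ) ^ β * u N) :=
          (mul_le_mul_of_nonneg_right h2 (hpos _).le).trans
            (h1.trans (mul_le_mul_of_nonneg_left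
              (mul_le_mul_of_nonneg_right h3 (hpos N).le) hC.le))
        have hNβ : (0 : ℝ) < (N : ℝ) ^ β := by positivity
        have hxβ : (0 : ℝ) < x ^ β := by positivity
        have h5 : u ⌊(N : ℝ) * x⌋₊ / u N ≤ C * 2 ^ β * x ^ (-β) := by
          rw [Real.rpow_neg hx.le, ← div_eq_mul_inv, div_le_div_iff₀ (hpos N) hxβ]
          refine le_of_mul_le_mul_left ?_ hNβ
          linarith
        linarith
      · have h1 : u ⌊(N : ℝ) * x⌋₊ / u N ≤ 1 := (div_le_one (hpos N)).2 (hanti h)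
        have h2 : 0 ≤ C * 2 ^ β * x ^ (-β) := by positivity
        linarith
    have he : Real.exp (-(j / N * ⌊(N : ℝ) * x⌋₊)) ≤ Real.exp j * Real.exp (-j * x) := by
      rw [← Real.exp_add]
      refine Real.exp_le_exp.2 ?_
      have h1 : N * x - 1 ≤ ⌊(N : ℝ) * x⌋₊ := (Nat.sub_one_lt_floor _).le
      have h2 := mul_le_mul_of_nonneg_left h1 (div_pos hj hN0).le
      have h3 : j / N * (N * x - 1) = j * x - j / N := by field_simp
      have h4 : j / N ≤ j := div_le_self hj.le hN'
      linarith
    have hu0 : 0 ≤ u ⌊(N : ℝ) * x⌋₊ / u N := (div_pos (hpos _) (hpos _)).le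
    simp only [hf, bound]
    rw [Real.norm_of_nonneg (mul_nonneg hu0 (Real.exp_pos _).le)]
    exact mul_le_mul hu he (Real.exp_pos _).le (hu0.trans hu)
  · have h1 : IntegrableOn (fun x : ℝ => x ^ (-β) * Real.exp (-j * x ^ (1 : ℝ))) (Ioi 0) :=
      integrableOn_rpow_mul_exp_neg_mul_rpow (by linarith) one_pos hj
    have h2 : IntegrableOn (fun x : ℝ => x ^ (0 : ℝ) * Real.exp (-j * x ^ (1 : ℝ))) (Ioi 0) :=
      integrableOn_rpow_mul_exp_neg_mul_rpow (by norm_num) one_pos hj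
    simp only [Real.rpow_one, Real.rpow_zero] at h1 h2
    refine ((h1.const_mul (C * 2 ^ β * Real.exp j)).add
      (h2.const_mul (Real.exp j))).congr (Eventually.of_forall fun x => ?_)
    simp only [bound, Pi.add_apply]
    ring
  · refine (ae_restrict_iff' measurableSet_Ioi).2 (Eventually.of_forall fun x hx => ?_)
    have hx : 0 < x := hx
    have hNx : Tendsto (fun N : ℕ => (N : ℝ) * x) atTop atTop :=
      tendsto_natCast_atTop_atTop.atTop_mul_const hx
    have hfl : Tendsto (fun N : ℕ => (⌊(N : ℝ) * x⌋₊ : ℝ) / N) atTop (𝓝 x) := by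
      have := (tendsto_nat_floor_mul_div_atTop hx.le).comp tendsto_natCast_atTop_atTop
      refine this.congr fun N => ?_
      simp only [Function.comp, mul_comm]
    have h1 := tendsto_div_of_tendsto_nat_mul hpos hlim hx
      (tendsto_nat_floor_atTop.comp hNx) tendsto_id hfl
    rw [show 1 - δ - 1 = -δ by ring]
    refine h1.mul ((Real.continuous_exp.tendsto _).comp ?_)
    refine (hfl.const_mul j).neg.congr fun N => ?_
    ring

/-! ### A Tauberian theorem -/

theorem exp_neg_mem_Icc {x : ℝ} (hx : 0 ≤ x) : Real.exp (-x) ∈ Icc (0 : ℝ) 1 :=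
  ⟨(Real.exp_pos _).le, Real.exp_le_one_iff.2 (by linarith)⟩

theorem integrableOn_rpow_mul_exp_neg {ρ : ℝ} (hρ : 0 < ρ) :
    IntegrableOn (fun x : ℝ => x ^ (ρ - 1) * Real.exp (-x)) (Ioi 0) :=
  (Real.GammaIntegral_convergent hρ).congr (Eventually.of_forall fun x => by
    simp only [mul_comm])

theorem integrableOn_rpow_mul_exp_neg_mul {ρ : ℝ} (hρ : 0 < ρ) {φ : ℝ → ℝ} (hφ : Continuous φ) :
    IntegrableOn (fun x : ℝ => x ^ (ρ - 1) * Real.exp (-x) * φ (Real.exp (-x))) (Ioi 0) := by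
  obtain ⟨B, hB⟩ := isCompact_Icc.exists_bound_of_continuousOn (s := Icc (0 : ℝ) 1) hφ.continuousOn
  refine (integrableOn_rpow_mul_exp_neg hρ).mul_bdd (c := B) ?_ ?_
  · exact (hφ.comp (Real.continuous_exp.comp continuous_neg)).aestronglyMeasurable
  · exact (ae_restrict_iff' measurableSet_Ioi).2 (Eventually.of_forall fun x hx =>
      hB _ (exp_neg_mem_Icc (le_of_lt hx)))

section laplace

variable {r : ℕ → ℝ} {B : ℝ} {φ : ℝ → ℝ}

theorem summable_mul_exp_neg_mul (h0 : ∀ n, 0 ≤ r n) (hB : ∀ n, r n ≤ B) (hφ : Continuous φ)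
    {s : ℝ} (hs : 0 < s) :
    Summable fun n : ℕ => r n * Real.exp (-(s * n)) * φ (Real.exp (-(s * n))) := by
  obtain ⟨D, hD⟩ := isCompact_Icc.exists_bound_of_continuousOn (s := Icc (0 : ℝ) 1) hφ.continuousOn
  refine Summable.of_norm_bounded ((summable_mul_exp_neg h0 hB hs).mul_right D) fun n => ?_
  rw [norm_mul, Real.norm_of_nonneg (mul_nonneg (h0 n) (Real.exp_pos _).le)]
  exact mul_le_mul_of_nonneg_left (hD _ (exp_neg_mem_Icc (by positivity)))
    (mul_nonneg (h0 n) (Real.exp_pos _).le)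

/-- Convergence of the rescaled Laplace transforms of `r` at the positive integers extends, by
the Weierstrass theorem, to all test functions `e⁻ˣ φ (e⁻ˣ)` with `φ` continuous. -/
theorem tendsto_tsum_mul_comp_exp {w : ℕ → ℝ} {C ρ : ℝ} (h0 : ∀ n, 0 ≤ r n)
    (hB : ∀ n, r n ≤ B) (hw : ∀ N, 0 ≤ w N) (hC : 0 ≤ C) (hρ : 0 < ρ)
    (hlap : ∀ j : ℕ, 0 < j → Tendsto
      (fun N : ℕ => w N * ∑' n : ℕ, r n * Real.exp (-((j : ℝ) / N * n))) atTop
      (𝓝 (C * ((1 / (j : ℝ)) ^ ρ * Real.Gamma ρ)))) (hφ : Continuous φ) :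
    Tendsto (fun N : ℕ => w N * ∑' n : ℕ,
      r n * Real.exp (-(1 / (N : ℝ) * n)) * φ (Real.exp (-(1 / (N : ℝ) * n)))) atTop
      (𝓝 (C * ∫ x in Ioi (0 : ℝ), x ^ (ρ - 1) * Real.exp (-x) * φ (Real.exp (-x)))) := by
  have hinv : ∀ {N : ℕ}, 0 < N → (0 : ℝ) < 1 / N := fun hN => by positivity
  have hpoly : ∀ p : Polynomial ℝ, Tendsto (fun N : ℕ => w N * ∑' n : ℕ,
      r n * Real.exp (-(1 / (N : ℝ) * n)) * p.eval (Real.exp (-(1 / (N : ℝ) * n)))) atTop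
      (𝓝 (C * ∫ x in Ioi (0 : ℝ), x ^ (ρ - 1) * Real.exp (-x) * p.eval (Real.exp (-x)))) := by
    intro p
    induction p using Polynomial.induction_on' with
    | add p q hp hq =>
      simp only [Polynomial.eval_add, mul_add]
      rw [integral_add (integrableOn_rpow_mul_exp_neg_mul hρ p.continuous)
        (integrableOn_rpow_mul_exp_neg_mul hρ q.continuous), mul_add]
      refine (hp.add hq).congr' ?_
      filter_upwards [eventually_gt_atTop 0] with N hN
      rw [(summable_mul_exp_neg_mul h0 hB p.continuous (hinv hN)).tsum_add
        (summable_mul_exp_neg_mul h0 hB q.continuous (hinv hN)), mul_add]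
    | monomial i c =>
      have h1 := (hlap (i + 1) (Nat.succ_pos i)).const_mul c
      have h2 : ∫ x in Ioi (0 : ℝ),
          x ^ (ρ - 1) * Real.exp (-x) * (Polynomial.monomial i c).eval (Real.exp (-x)) =
          c * ((1 / ((i + 1 : ℕ) : ℝ)) ^ ρ * Real.Gamma ρ) := by
        rw [← Real.integral_rpow_mul_exp_neg_mul_Ioi hρ (by positivity), ← integral_const_mul]
        refine integral_congr_ae (Eventually.of_forall fun x => ?_)
        simp only [Polynomial.eval_monomial]
        rw [← Real.exp_nat_mul, show -(((i + 1 : ℕ) : ℝ) * x) = -x + i * -x by push_cast; ring,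
          Real.exp_add]
        ring
      rw [h2, mul_left_comm]
      refine h1.congr fun N => ?_
      rw [mul_left_comm, ← tsum_mul_left]
      congr 1
      refine tsum_congr fun n => ?_
      rw [Polynomial.eval_monomial, ← Real.exp_nat_mul,
        show -(((i + 1 : ℕ) : ℝ) / N * n) = -(1 / (N : ℝ) * n) + i * -(1 / (N : ℝ) * n) by
          push_cast; ring, Real.exp_add]
      ring
  have hone := hlap 1 one_pos
  rw [Nat.cast_one, div_one, Real.one_rpow, one_mul] at hone
  have hG := Real.Gamma_pos_of_pos hρ
  set K := C * Real.Gamma ρ + 1 with hK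
  have hK0 : 0 < K := by positivity
  rw [Metric.tendsto_atTop]
  intro ε hε
  obtain ⟨p, hp⟩ := exists_polynomial_near_of_continuousOn 0 1 φ hφ.continuousOn (ε / (3 * K))
    (by positivity)
  have hp' : ∀ x : ℝ, 0 ≤ x →
      |φ (Real.exp (-x)) - p.eval (Real.exp (-x))| ≤ ε / (3 * K) := fun x hx => by
    rw [abs_sub_comm]
    exact (hp _ (exp_neg_mem_Icc hx)).le
  have hI : |C * (∫ x in Ioi (0 : ℝ), x ^ (ρ - 1) * Real.exp (-x) * φ (Real.exp (-x))) -
      C * ∫ x in Ioi (0 : ℝ), x ^ (ρ - 1) * Real.exp (-x) * p.eval (Real.exp (-x))| ≤ ε / 3 := by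
    rw [← mul_sub, ← integral_sub (integrableOn_rpow_mul_exp_neg_mul hρ hφ)
      (integrableOn_rpow_mul_exp_neg_mul hρ p.continuous), abs_mul, abs_of_nonneg hC]
    have h1 : |∫ x in Ioi (0 : ℝ), (x ^ (ρ - 1) * Real.exp (-x) * φ (Real.exp (-x)) -
        x ^ (ρ - 1) * Real.exp (-x) * p.eval (Real.exp (-x)))| ≤
        ∫ x in Ioi (0 : ℝ), x ^ (ρ - 1) * Real.exp (-x) * (ε / (3 * K)) := by
      rw [← Real.norm_eq_abs]
      refine norm_integral_le_of_norm_le ((integrableOn_rpow_mul_exp_neg hρ).mul_const _) ?_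
      refine (ae_restrict_iff' measurableSet_Ioi).2 (Eventually.of_forall fun x hx => ?_)
      have hx : 0 < x := hx
      rw [← mul_sub, norm_mul, Real.norm_of_nonneg (by positivity)]
      exact mul_le_mul_of_nonneg_left (hp' x hx.le) (by positivity)
    have h2 : ∫ x in Ioi (0 : ℝ), x ^ (ρ - 1) * Real.exp (-x) = Real.Gamma ρ := by
      rw [Real.Gamma_eq_integral hρ]
      simp only [mul_comm]
    rw [integral_mul_const, h2] at h1
    calc _ ≤ C * (Real.Gamma ρ * (ε / (3 * K))) := mul_le_mul_of_nonneg_left h1 hC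
      _ = C * Real.Gamma ρ * (ε / (3 * K)) := by ring
      _ ≤ K * (ε / (3 * K)) := mul_le_mul_of_nonneg_right (by linarith) (by positivity)
      _ = ε / 3 := by field_simp
  obtain ⟨N₀, hN₀⟩ := (Metric.tendsto_atTop.1 (hpoly p)) (ε / 3) (by positivity)
  obtain ⟨N₁, hN₁⟩ := eventually_atTop.1 (hone.eventually (gt_mem_nhds (show _ < K by
    rw [hK]; linarith)))
  refine ⟨max (max N₀ N₁) 1, fun N hN => ?_⟩
  have hN0 : 0 < N := (le_max_right _ _).trans hN
  have hp1 := hN₀ N ((le_max_left _ _).trans ((le_max_left _ _).trans hN))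
  have hK1 := hN₁ N ((le_max_right _ _).trans ((le_max_left _ _).trans hN))
  have hT : |w N * (∑' n : ℕ,
      r n * Real.exp (-(1 / (N : ℝ) * n)) * φ (Real.exp (-(1 / (N : ℝ) * n)))) - w N * ∑' n : ℕ,
      r n * Real.exp (-(1 / (N : ℝ) * n)) * p.eval (Real.exp (-(1 / (N : ℝ) * n)))| ≤ ε / 3 := by
    have hs := summable_mul_exp_neg h0 hB (hinv hN0)
    rw [← mul_sub, ← (summable_mul_exp_neg_mul h0 hB hφ (hinv hN0)).tsum_sub
      (summable_mul_exp_neg_mul h0 hB p.continuous (hinv hN0)), abs_mul, abs_of_nonneg (hw N)]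
    have h1 := tsum_of_norm_bounded (hs.mul_right (ε / (3 * K))).hasSum
      (f := fun n : ℕ => r n * Real.exp (-(1 / (N : ℝ) * n)) * φ (Real.exp (-(1 / (N : ℝ) * n))) -
        r n * Real.exp (-(1 / (N : ℝ) * n)) * p.eval (Real.exp (-(1 / (N : ℝ) * n)))) (by
      intro n
      rw [← mul_sub, norm_mul, Real.norm_of_nonneg (mul_nonneg (h0 n) (Real.exp_pos _).le)]
      exact mul_le_mul_of_nonneg_left (hp' _ (by positivity))
        (mul_nonneg (h0 n) (Real.exp_pos _).le))
    rw [tsum_mul_right, Real.norm_eq_abs] at h1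
    calc _ ≤ w N * ((∑' n : ℕ, r n * Real.exp (-(1 / (N : ℝ) * n))) * (ε / (3 * K))) :=
          mul_le_mul_of_nonneg_left h1 (hw N)
      _ = w N * (∑' n : ℕ, r n * Real.exp (-(1 / (N : ℝ) * n))) * (ε / (3 * K)) := by ring
      _ ≤ K * (ε / (3 * K)) := mul_le_mul_of_nonneg_right hK1.le (by positivity)
      _ = ε / 3 := by field_simp
  rw [Real.dist_eq] at hp1 ⊢
  rw [abs_le] at hT hI
  rw [abs_lt] at hp1 ⊢
  constructor <;> linarith [hT.1, hT.2, hI.1, hI.2, hp1.1, hp1.2]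

end laplace

theorem tendsto_nat_mul_one_sub_exp (j : ℝ) :
    Tendsto (fun N : ℕ => (N : ℝ) * (1 - Real.exp (-(j / N)))) atTop (𝓝 j) := by
  have hd : HasDerivAt (fun h : ℝ => 1 - Real.exp (-(j * h))) j 0 := by
    have h := (((hasDerivAt_id (0 : ℝ)).const_mul j).neg.exp).const_sub 1
    simpa using h
  have ht : Tendsto (fun N : ℕ => (N : ℝ)⁻¹) atTop (𝓝[≠] 0) :=
    tendsto_nhdsWithin_iff.2 ⟨tendsto_inv_atTop_nhds_zero_nat, by
      filter_upwards [eventually_gt_atTop 0] with N hN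
      exact inv_ne_zero (by positivity)⟩
  refine (hd.tendsto_slope_zero.comp ht).congr fun N => ?_
  simp [div_eq_mul_inv]

theorem tsum_exp_neg {s : ℝ} (hs : 0 < s) :
    ∑' n : ℕ, Real.exp (-(s * n)) = (1 - Real.exp (-s))⁻¹ := by
  rw [← tsum_geometric_of_lt_one (Real.exp_pos _).le (by simpa using hs)]
  refine tsum_congr fun n => ?_
  rw [← Real.exp_nat_mul]
  congr 1
  ring

/-- A continuous bump function `φ` for which `x ↦ φ (e⁻ˣ)` is positive exactly on `(a, b)`. -/
noncomputable def expBump (a b y : ℝ) : ℝ := max 0 ((y - Real.exp (-b)) * (Real.exp (-a) - y))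

theorem continuous_expBump (a b : ℝ) : Continuous (expBump a b) := by
  unfold expBump
  fun_prop

theorem expBump_nonneg (a b y : ℝ) : 0 ≤ expBump a b y := le_max_left _ _

theorem expBump_pos {a b x : ℝ} (h1 : a < x) (h2 : x < b) : 0 < expBump a b (Real.exp (-x)) :=
  lt_max_of_lt_right (mul_pos (sub_pos.2 (Real.exp_lt_exp.2 (by linarith)))
    (sub_pos.2 (Real.exp_lt_exp.2 (by linarith))))

theorem expBump_eq_zero {a b x : ℝ} (hab : a < b) (h : x ≤ a ∨ b ≤ x) :
    expBump a b (Real.exp (-x)) = 0 := by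
  refine max_eq_left ?_
  rcases h with h | h
  · exact mul_nonpos_of_nonneg_of_nonpos
      (sub_nonneg.2 (Real.exp_le_exp.2 (by linarith)))
      (sub_nonpos.2 (Real.exp_le_exp.2 (by linarith)))
  · exact mul_nonpos_of_nonpos_of_nonneg
      (sub_nonpos.2 (Real.exp_le_exp.2 (by linarith)))
      (sub_nonneg.2 (Real.exp_le_exp.2 (by linarith)))

/-- Karamata's Tauberian theorem with monotone density: if the Laplace transforms of the
nonincreasing sequence `r`, rescaled by `w`, converge to those of `C x ^ (ρ - 1)`, `ρ ≤ 1`, then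
`N w N r N → C`. Testing against a bump function supported just to the left or just to the right
of `1` bounds `r N` from above or from below. -/
theorem tendsto_of_tendsto_laplace_of_antitone {r w : ℕ → ℝ} {C ρ : ℝ} (h0 : ∀ n, 0 ≤ r n)
    (hanti : Antitone r) (hw : ∀ N, 0 ≤ w N) (hC : 0 ≤ C) (hρ0 : 0 < ρ) (hρ1 : ρ ≤ 1)
    (hlap : ∀ j : ℕ, 0 < j → Tendsto
      (fun N : ℕ => w N * ∑' n : ℕ, r n * Real.exp (-((j : ℝ) / N * n))) atTop
      (𝓝 (C * ((1 / (j : ℝ)) ^ ρ * Real.Gamma ρ)))) :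
    Tendsto (fun N : ℕ => (N : ℝ) * w N * r N) atTop (𝓝 C) := by
  -- The constant sequence, with `ρ = 1`, provides the normalisation.
  have hlap1 : ∀ j : ℕ, 0 < j → Tendsto
      (fun N : ℕ => (1 / (N : ℝ)) * ∑' n : ℕ, 1 * Real.exp (-((j : ℝ) / N * n))) atTop
      (𝓝 (1 * ((1 / (j : ℝ)) ^ (1 : ℝ) * Real.Gamma 1))) := by
    intro j hj
    have hj' : (0 : ℝ) < j := by exact_mod_cast hj
    rw [Real.Gamma_one, mul_one, one_mul, Real.rpow_one, one_div]
    refine ((tendsto_nat_mul_one_sub_exp (j : ℝ)).inv₀ hj'.ne').congr' ?_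
    filter_upwards [eventually_gt_atTop 0] with N hN
    simp only [one_mul]
    rw [tsum_exp_neg (by positivity), mul_inv, one_div]
  have key := fun a b : ℝ => tendsto_tsum_mul_comp_exp h0 (fun n => hanti (Nat.zero_le n)) hw hC
    hρ0 hlap (continuous_expBump a b)
  have key1 := fun a b : ℝ => tendsto_tsum_mul_comp_exp (r := fun _ => 1) (B := 1)
    (w := fun N : ℕ => 1 / (N : ℝ)) (fun _ => zero_le_one) (fun _ => le_rfl)
    (fun N => by positivity) zero_le_one one_pos hlap1 (continuous_expBump a b)
  set T : ℝ → ℝ → ℕ → ℝ := fun a b N => w N * ∑' n : ℕ,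
    r n * Real.exp (-(1 / (N : ℝ) * n)) * expBump a b (Real.exp (-(1 / (N : ℝ) * n))) with hT
  set S : ℝ → ℝ → ℕ → ℝ := fun a b N => 1 / (N : ℝ) * ∑' n : ℕ,
    1 * Real.exp (-(1 / (N : ℝ) * n)) * expBump a b (Real.exp (-(1 / (N : ℝ) * n))) with hS
  set I : ℝ → ℝ → ℝ := fun a b => ∫ x in Ioi (0 : ℝ),
    x ^ (ρ - 1) * Real.exp (-x) * expBump a b (Real.exp (-x)) with hI
  set J : ℝ → ℝ → ℝ := fun a b => ∫ x in Ioi (0 : ℝ),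
    x ^ ((1 : ℝ) - 1) * Real.exp (-x) * expBump a b (Real.exp (-x)) with hJ
  have hJpos : ∀ a b, 0 < a → a < b → 0 < J a b := by
    intro a b ha hab
    rw [hJ, setIntegral_pos_iff_support_of_nonneg_ae]
    · refine lt_of_lt_of_le ?_ (measure_mono (s := Ioo a b) fun x hx => ⟨?_, ha.trans hx.1⟩)
      · simpa using hab
      · have := expBump_pos hx.1 hx.2
        simp only [sub_self, Real.rpow_zero, one_mul, Function.mem_support]
        positivity
    · refine Eventually.of_forall fun x => ?_
      simp only [sub_self, Real.rpow_zero, one_mul]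
      exact mul_nonneg (Real.exp_pos _).le (expBump_nonneg _ _ _)
    · exact integrableOn_rpow_mul_exp_neg_mul one_pos (continuous_expBump a b)
  have hIJ : ∀ a b, 0 < a → a < b →
      I a b ≤ a ^ (ρ - 1) * J a b ∧ b ^ (ρ - 1) * J a b ≤ I a b := by
    intro a b ha hab
    have hi := integrableOn_rpow_mul_exp_neg_mul hρ0 (continuous_expBump a b)
    have hj := integrableOn_rpow_mul_exp_neg_mul one_pos (continuous_expBump a b)
    simp only [hI, hJ]
    rw [← integral_const_mul, ← integral_const_mul]
    have hzero : ∀ x : ℝ, ¬ (a < x ∧ x < b) → expBump a b (Real.exp (-x)) = 0 := fun x hx =>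
      expBump_eq_zero hab (by by_contra! h; exact hx h)
    constructor
    · refine setIntegral_mono_on hi (hj.const_mul _) measurableSet_Ioi fun x hx => ?_
      by_cases hx' : a < x ∧ x < b
      · rw [sub_self, Real.rpow_zero, one_mul, mul_assoc]
        exact mul_le_mul_of_nonneg_right
          (Real.rpow_le_rpow_of_nonpos ha hx'.1.le (by linarith))
          (mul_nonneg (Real.exp_pos _).le (expBump_nonneg _ _ _))
      · simp [hzero x hx']
    · refine setIntegral_mono_on (hj.const_mul _) hi measurableSet_Ioi fun x hx => ?_
      by_cases hx' : a < x ∧ x < b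
      · rw [sub_self, Real.rpow_zero, one_mul, mul_assoc]
        exact mul_le_mul_of_nonneg_right
          (Real.rpow_le_rpow_of_nonpos hx hx'.2.le (by linarith))
          (mul_nonneg (Real.exp_pos _).le (expBump_nonneg _ _ _))
      · simp [hzero x hx']
  have hXS : ∀ (a b : ℝ) (N : ℕ), (N : ℝ) ≠ 0 → (N : ℝ) * w N * r N * S a b N = w N * ∑' n : ℕ,
      r N * Real.exp (-(1 / (N : ℝ) * n)) * expBump a b (Real.exp (-(1 / (N : ℝ) * n))) := by
    intro a b N hN
    simp only [hS, one_mul]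
    rw [show (N : ℝ) * w N * r N * (1 / (N : ℝ) * ∑' n : ℕ, Real.exp (-(1 / (N : ℝ) * n)) *
      expBump a b (Real.exp (-(1 / (N : ℝ) * n)))) = w N * (r N * ∑' n : ℕ,
      Real.exp (-(1 / (N : ℝ) * n)) * expBump a b (Real.exp (-(1 / (N : ℝ) * n)))) by
        field_simp, ← tsum_mul_left]
    simp only [mul_assoc]
  have hsumr : ∀ a b (N : ℕ), 0 < N → Summable fun n : ℕ => r n * Real.exp (-(1 / (N : ℝ) * n)) *
      expBump a b (Real.exp (-(1 / (N : ℝ) * n))) := fun a b N hN =>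
    summable_mul_exp_neg_mul h0 (fun n => hanti (Nat.zero_le n)) (continuous_expBump a b)
      (by positivity)
  have hsumc : ∀ a b (N : ℕ), 0 < N → Summable fun n : ℕ => r N * Real.exp (-(1 / (N : ℝ) * n)) *
      expBump a b (Real.exp (-(1 / (N : ℝ) * n))) := fun a b N hN =>
    summable_mul_exp_neg_mul (fun _ => h0 N) (fun _ => le_rfl) (continuous_expBump a b)
      (by positivity)
  have hupper : ∀ a (N : ℕ), 0 < N → a < 1 → (N : ℝ) * w N * r N * S a 1 N ≤ T a 1 N := by
    intro a N hN ha
    have hN' : (0 : ℝ) < N := by exact_mod_cast hN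
    rw [hXS _ _ _ hN'.ne']
    refine mul_le_mul_of_nonneg_left
      ((hsumc a 1 N hN).tsum_le_tsum (fun n => ?_) (hsumr a 1 N hN)) (hw N)
    rcases le_total n N with h | h
    · gcongr
      · exact expBump_nonneg _ _ _
      · exact hanti h
    · rw [expBump_eq_zero ha (Or.inr (by
        rw [one_div_mul_eq_div, le_div_iff₀ hN', one_mul]; exact_mod_cast h)), mul_zero, mul_zero]
  have hlower : ∀ b (N : ℕ), 0 < N → 1 < b → T 1 b N ≤ (N : ℝ) * w N * r N * S 1 b N := by
    intro b N hN hb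
    have hN' : (0 : ℝ) < N := by exact_mod_cast hN
    rw [hXS _ _ _ hN'.ne']
    refine mul_le_mul_of_nonneg_left
      ((hsumr 1 b N hN).tsum_le_tsum (fun n => ?_) (hsumc 1 b N hN)) (hw N)
    rcases le_total N n with h | h
    · gcongr
      · exact expBump_nonneg _ _ _
      · exact hanti h
    · rw [expBump_eq_zero hb (Or.inl (by
        rw [one_div_mul_eq_div, div_le_iff₀ hN', one_mul]; exact_mod_cast h)), mul_zero, mul_zero]
  have hcont : Tendsto (fun a : ℝ => C * a ^ (ρ - 1)) (𝓝 1) (𝓝 C) := by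
    have h := ((Real.continuousAt_rpow_const 1 (ρ - 1) (Or.inl one_ne_zero)).tendsto).const_mul C
    rwa [Real.one_rpow, mul_one] at h
  have hratio : ∀ a b, 0 < a → a < b →
      Tendsto (fun N => T a b N / S a b N) atTop (𝓝 (C * I a b / J a b)) := by
    intro a b ha hab
    have h := key1 a b
    rw [one_mul] at h
    exact (key a b).div h (hJpos a b ha hab).ne'
  have hSpos : ∀ a b, 0 < a → a < b → ∀ᶠ N in atTop, 0 < S a b N := by
    intro a b ha hab
    have h := key1 a b
    rw [one_mul] at h
    exact h.eventually (lt_mem_nhds (hJpos a b ha hab))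
  rw [tendsto_order]
  constructor
  · intro l hl
    have h1 : ∀ᶠ b in 𝓝[>] (1 : ℝ), l < C * b ^ (ρ - 1) :=
      (hcont.mono_left nhdsWithin_le_nhds).eventually (lt_mem_nhds hl)
    obtain ⟨b, hb1, hb2⟩ := (h1.and self_mem_nhdsWithin).exists
    have hb2 : 1 < b := hb2
    have hJ0 := hJpos 1 b one_pos hb2
    have hlt : l < C * I 1 b / J 1 b := by
      refine hb1.trans_le ?_
      rw [le_div_iff₀ hJ0, mul_assoc]
      exact mul_le_mul_of_nonneg_left (hIJ 1 b one_pos hb2).2 hC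
    filter_upwards [(hratio 1 b one_pos hb2).eventually (lt_mem_nhds hlt),
      hSpos 1 b one_pos hb2, eventually_gt_atTop 0] with N hN1 hN2 hN3
    refine hN1.trans_le ?_
    rw [div_le_iff₀ hN2]
    exact hlower b N hN3 hb2
  · intro l hl
    have h1 : ∀ᶠ a in 𝓝[<] (1 : ℝ), C * a ^ (ρ - 1) < l :=
      (hcont.mono_left nhdsWithin_le_nhds).eventually (gt_mem_nhds hl)
    have h2 : ∀ᶠ a in 𝓝[<] (1 : ℝ), 0 < a := nhdsWithin_le_nhds (lt_mem_nhds one_pos)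
    obtain ⟨a, ha1, ha0, ha2⟩ := (h1.and (h2.and self_mem_nhdsWithin)).exists
    have ha2 : a < 1 := ha2
    have hJ0 := hJpos a 1 ha0 ha2
    have hlt : C * I a 1 / J a 1 < l := by
      refine lt_of_le_of_lt ?_ ha1
      rw [div_le_iff₀ hJ0, mul_assoc]
      exact mul_le_mul_of_nonneg_left (hIJ a 1 ha0 ha2).1 hC
    filter_upwards [(hratio a 1 ha0 ha2).eventually (gt_mem_nhds hlt),
      hSpos a 1 ha0 ha2, eventually_gt_atTop 0] with N hN1 hN2 hN3
    refine lt_of_le_of_lt ?_ hN1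
    rw [le_div_iff₀ hN2]
    exact hupper a N hN3 ha2

/-- Tail asymptotics from the renewal equation: if `∑_{k ≤ n} u k r (n - k) = 1` for all `n` and
`u` is nonincreasing and regularly varying with index `-δ`, `0 < δ < 1`, then
`r n ∼ 1 / (Γ(δ) Γ(1 - δ) n u n)`. -/
theorem tendsto_of_renewal {u r : ℕ → ℝ} {δ : ℝ} (hpos : ∀ n, 0 < u n) (hanti : Antitone u)
    (hlim : Tendsto (fun n : ℕ => (n : ℝ) * (1 - u (n + 1) / u n)) atTop (𝓝 δ))
    (hδ0 : 0 < δ) (hδ1 : δ < 1) (h0 : ∀ n, 0 ≤ r n) (hr : Antitone r)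
    (hren : ∀ n, ∑ k ∈ Finset.range (n + 1), u k * r (n - k) = 1) :
    Tendsto (fun N : ℕ => (N : ℝ) * u N * r N) atTop
      (𝓝 (1 / (Real.Gamma δ * Real.Gamma (1 - δ)))) := by
  have hG := Real.Gamma_pos_of_pos hδ0
  have hG' := Real.Gamma_pos_of_pos (show 0 < 1 - δ by linarith)
  refine tendsto_of_tendsto_laplace_of_antitone h0 hr (fun N => (hpos N).le) (by positivity)
    hδ0 hδ1.le fun j hj => ?_
  have hj' : (0 : ℝ) < j := by exact_mod_cast hj
  have h1 := ((tendsto_nat_mul_one_sub_exp (j : ℝ)).mul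
    (tendsto_laplace_of_regularlyVarying hpos hanti hlim hδ0.le hδ1 hj')).inv₀ (by positivity)
  have h2 : (j * ((1 / (j : ℝ)) ^ (1 - δ) * Real.Gamma (1 - δ)))⁻¹ =
      1 / (Real.Gamma δ * Real.Gamma (1 - δ)) * ((1 / (j : ℝ)) ^ δ * Real.Gamma δ) := by
    rw [Real.rpow_sub (by positivity), Real.rpow_one]
    field_simp
  rw [h2] at h1
  refine h1.congr' ?_
  filter_upwards [eventually_gt_atTop 0] with N hN
  have hN' : (0 : ℝ) < N := by exact_mod_cast hN
  have hs : 0 < (j : ℝ) / N := by positivity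
  have hsu := summable_mul_exp_neg (fun n => (hpos n).le) (fun n => hanti (Nat.zero_le n)) hs
  have hsr := summable_mul_exp_neg h0 (fun n => hr (Nat.zero_le n)) hs
  have hprod := tsum_mul_tsum_eq_tsum_sum_range_of_summable_norm hsu.norm hsr.norm
  have hconv : ∀ n : ℕ, ∑ k ∈ Finset.range (n + 1), u k * Real.exp (-((j : ℝ) / N * k)) *
      (r (n - k) * Real.exp (-((j : ℝ) / N * (n - k : ℕ)))) =
      Real.exp (-((j : ℝ) / N * n)) := by
    intro n
    rw [← mul_one (Real.exp _), ← hren n, Finset.mul_sum]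
    refine Finset.sum_congr rfl fun k hk => ?_
    have hk' : k ≤ n := by have := Finset.mem_range.1 hk; omega
    rw [Nat.cast_sub hk', show -((j : ℝ) / N * n) =
      -((j : ℝ) / N * k) + -((j : ℝ) / N * (n - k)) by ring, Real.exp_add]
    ring
  simp only [hconv] at hprod
  rw [tsum_exp_neg hs] at hprod
  have hlt : 0 < 1 - Real.exp (-((j : ℝ) / N)) := sub_pos.2 (by simpa using hs)
  have hU : ∑' n : ℕ, u n * Real.exp (-((j : ℝ) / N * n)) ≠ 0 := by
    intro h
    rw [h, zero_mul] at hprod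
    exact (inv_pos.2 hlt).ne hprod
  have hR : ∑' n : ℕ, r n * Real.exp (-((j : ℝ) / N * n)) =
      (1 - Real.exp (-((j : ℝ) / N)))⁻¹ / ∑' n : ℕ, u n * Real.exp (-((j : ℝ) / N * n)) := by
    rw [eq_div_iff hU, mul_comm]
    exact hprod
  rw [hR]
  have := (hpos N).ne'
  field_simp

/-! ### Asymptotics of the zero probabilities and of the first return time -/

theorem toReal_prod_egenFun (μ ν : PMF ℕ) (n : ℕ) :
    (∏ j ∈ Finset.range n, ν.egenFun (μ.egenFun^[j] 0)).toReal =
      ∏ j ∈ Finset.range n, genFun ν ((genFun μ)^[j] 0) := by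
  rw [ENNReal.toReal_prod]
  refine Finset.prod_congr rfl fun j _ => ?_
  have hj := iterate_genFun_mem_Icc μ j
  rw [iterate_egenFun_zero, ofReal_genFun ν hj, ENNReal.toReal_ofReal (genFun_mem_Icc ν hj).1]

theorem tendsto_add_one_div_rpow (δ : ℝ) :
    Tendsto (fun n : ℕ => (((n : ℝ) + 1) / n) ^ δ) atTop (𝓝 1) := by
  have h : Tendsto (fun n : ℕ => 1 + (n : ℝ)⁻¹) atTop (𝓝 (1 + 0)) :=
    tendsto_inv_atTop_nhds_zero_nat.const_add 1
  rw [add_zero] at h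
  have h' := h.rpow_const (p := δ) (Or.inl one_ne_zero)
  rw [Real.one_rpow] at h'
  refine h'.congr' ?_
  filter_upwards [eventually_gt_atTop 0] with n hn
  congr 1
  field_simp

theorem lemma8 {Ω : Type*} [MeasurableSpace Ω] (P : Measure Ω) [IsProbabilityMeasure P]
    (μ ν : PMF ℕ) (hμ : μ 1 < 1) (hν : 0 < ν 0)
    (c d α δ : ℝ) (hSL : AssumptionSL μ ν c d α) (hδ : δ = d / (c * α))
    (Z : ℕ → Ω → ℕ) (hZ : IsBGWI μ ν Z P) :
    ∃ lstar : ℝ → ℝ, SlowlyVaryingAtInfinity lstar ∧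
      (fun n : ℕ => P.real {ω | Z n ω = 0}) ~[atTop]
        (fun n : ℕ => lstar n * (n : ℝ) ^ (-δ)) ∧
      (δ ∈ Ioo (0 : ℝ) 1 →
        (fun n : ℕ => P.real {ω | (n : ℝ≥0∞) < zeroAfter 1 (stepPath fun m => Z m ω)}) ~[atTop]
          (fun n : ℕ =>
            1 / (Real.Gamma δ * Real.Gamma (1 - δ) * lstar n * (n : ℝ) ^ (1 - δ))) ∧
        (∀ n : ℕ, 0 < n →
          1 / (Real.Gamma δ * Real.Gamma (1 - δ) * lstar n * (n : ℝ) ^ (1 - δ)) =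
            Real.sin (Real.pi * δ) / Real.pi * (n : ℝ) ^ (δ - 1) / lstar n) ∧
        (fun n : ℕ => P.real {ω | (n : ℝ≥0∞) < zeroAfter 1 (stepPath fun m => Z m ω)}) ~[atTop]
          (fun n : ℕ => Real.sin (Real.pi * δ) / Real.pi * (n : ℝ) ^ (δ - 1) / lstar n)) := by
  obtain ⟨h0, hK⟩ := hZ.map_path
  have hZm : AEMeasurable (fun ω n => Z n ω) P := by
    obtain ⟨_, _, _, _, _, _, _, _, _, _, _, hid⟩ := hZ
    exact hid.aemeasurable_fst
  set M := P.map (fun ω n => Z n ω) with hM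
  have : IsProbabilityMeasure M := Measure.isProbabilityMeasure_map hZm
  set u : ℕ → ℝ := fun n => M.real {x | x n = 0} with hu
  set r : ℕ → ℝ := fun n => M.real (lastZeroSet 0 n) with hr
  set g : ℕ → ℝ := fun n => genFun ν ((genFun μ)^[n] 0) with hg
  have huprod : ∀ n, u n = ∏ j ∈ Finset.range n, g j := by
    intro n
    simp only [hu, Measure.real]
    rw [measure_apply_eq_zero h0 hK, toReal_prod_egenFun]
  have hgpos : ∀ n, 0 < g n := fun n =>
    (ENNReal.toReal_pos hν.ne' (ν.apply_ne_top 0)).trans_le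
      (apply_zero_le_genFun ν (iterate_genFun_mem_Icc μ n))
  have hpos : ∀ n, 0 < u n := fun n => by
    rw [huprod]; exact Finset.prod_pos fun j _ => hgpos j
  have hsucc : ∀ n, u (n + 1) = u n * g n := fun n => by
    rw [huprod, huprod, Finset.prod_range_succ]
  have hanti : Antitone u := antitone_nat_of_succ_le fun n => by
    rw [hsucc]
    exact mul_le_of_le_one_right (hpos n).le (genFun_mem_Icc ν (iterate_genFun_mem_Icc μ n)).2
  have hlim : Tendsto (fun n : ℕ => (n : ℝ) * (1 - u (n + 1) / u n)) atTop (𝓝 δ) := by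
    rw [hδ]
    refine hSL.tendsto_nat_mul.congr fun n => ?_
    rw [hsucc, mul_div_cancel_left₀ _ (hpos n).ne']
  have hPu : ∀ n, P.real {ω | Z n ω = 0} = u n := by
    intro n
    simp only [hu, hM, Measure.real]
    rw [Measure.map_apply_of_aemeasurable hZm (measurableSet_apply_eq n 0)]
    rfl
  set lstar : ℝ → ℝ := fun x => u ⌊x⌋₊ * (x + 1) ^ δ with hlstar
  have hlstar_nat : ∀ n : ℕ, lstar n = u n * ((n : ℝ) + 1) ^ δ := fun n => by
    simp [hlstar]
  have hlpos : ∀ n : ℕ, 0 < lstar n := fun n => by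
    rw [hlstar_nat]
    exact mul_pos (hpos n) (by positivity)
  refine ⟨lstar, slowlyVarying_floor_mul_rpow hpos hlim, ?_, ?_⟩
  · simp only [hPu]
    refine IsEquivalent.symm (isEquivalent_of_tendsto_one ?_)
    refine (tendsto_add_one_div_rpow δ).congr' ?_
    filter_upwards [eventually_gt_atTop 0] with n hn
    rw [Pi.div_apply, hlstar_nat, Real.rpow_neg (by positivity),
      Real.div_rpow (by positivity) (by positivity)]
    have := (hpos n).ne'
    field_simp
  · intro hδ01
    have hren : ∀ n, ∑ k ∈ Finset.range (n + 1), u k * r (n - k) = 1 := by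
      intro n
      have h := congrArg ENNReal.toReal (sum_measure_mul_lastZeroSet h0 hK n)
      rw [ENNReal.toReal_sum fun k _ => ENNReal.mul_ne_top (measure_ne_top _ _)
        (measure_ne_top _ _), ENNReal.toReal_one] at h
      rw [← h]
      exact Finset.sum_congr rfl fun k _ => ENNReal.toReal_mul.symm
    have hranti : Antitone r := fun m n hmn =>
      measureReal_mono fun x hx => ⟨hx.1, fun i hi him => hx.2 i hi (him.trans hmn)⟩
    have htail := tendsto_of_renewal hpos hanti hlim hδ01.1 hδ01.2
      (fun n => measureReal_nonneg) hranti hren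
    have hPr : ∀ n : ℕ, 1 ≤ n →
        P.real {ω | (n : ℝ≥0∞) < zeroAfter 1 (stepPath fun m => Z m ω)} = r n := by
      intro n hn
      simp only [hr, hM, Measure.real]
      rw [Measure.map_apply_of_aemeasurable hZm (measurableSet_lastZeroSet 0 n)]
      congr 1
      -- the two events differ at most where `Z 0 ≠ 0`, which has probability `0`
      have hzero : ∀ᵐ ω ∂P, Z 0 ω = 0 := by
        have h : ∀ᵐ x ∂M, x 0 = 0 := by
          rw [ae_iff]
          exact (prob_compl_eq_zero_iff (measurableSet_apply_eq 0 0)).2 h0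
        exact ae_of_ae_map hZm h
      refine measure_congr ?_
      filter_upwards [hzero] with ω hω
      refine propext ?_
      change (n : ℝ≥0∞) < zeroAfter 1 (stepPath fun m => Z m ω) ↔
        Z 0 ω = 0 ∧ ∀ i, 0 < i → i ≤ n → Z i ω ≠ 0
      rw [lt_zeroAfter_stepPath_iff _ hn]
      exact ⟨fun h => ⟨hω, h⟩, fun h => h.2⟩
    have hGpos := Real.Gamma_pos_of_pos hδ01.1
    have hGpos' := Real.Gamma_pos_of_pos (show 0 < 1 - δ by linarith [hδ01.2])
    have hmain : (fun n : ℕ =>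
        P.real {ω | (n : ℝ≥0∞) < zeroAfter 1 (stepPath fun m => Z m ω)}) ~[atTop]
        (fun n : ℕ => 1 / (Real.Gamma δ * Real.Gamma (1 - δ) * lstar n * (n : ℝ) ^ (1 - δ))) := by
      refine isEquivalent_of_tendsto_one ?_
      have h := (htail.mul (tendsto_add_one_div_rpow δ)).const_mul
        (Real.Gamma δ * Real.Gamma (1 - δ))
      rw [mul_one, mul_one_div_cancel (mul_pos hGpos hGpos').ne'] at h
      refine h.congr' ?_
      filter_upwards [eventually_ge_atTop 1] with n hn
      have hn' : (0 : ℝ) < n := by exact_mod_cast hn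
      rw [Pi.div_apply, hPr n hn, hlstar_nat, Real.div_rpow (by positivity) hn'.le,
        Real.rpow_sub hn', Real.rpow_one]
      field_simp
      rfl
    have hid : ∀ n : ℕ, 0 < n →
        1 / (Real.Gamma δ * Real.Gamma (1 - δ) * lstar n * (n : ℝ) ^ (1 - δ)) =
          Real.sin (Real.pi * δ) / Real.pi * (n : ℝ) ^ (δ - 1) / lstar n := by
      intro n hn
      have hn' : (0 : ℝ) < n := by exact_mod_cast hn
      have hsin : 0 < Real.sin (Real.pi * δ) :=
        Real.sin_pos_of_pos_of_lt_pi (mul_pos Real.pi_pos hδ01.1)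
          (mul_lt_of_lt_one_right Real.pi_pos hδ01.2)
      have hl := (hlpos n).ne'
      rw [Real.Gamma_mul_Gamma_one_sub, show δ - 1 = -(1 - δ) by ring, Real.rpow_neg hn'.le]
      have := Real.pi_pos.ne'
      field_simp
    refine ⟨hmain, hid, hmain.congr_right ?_⟩
    filter_upwards [eventually_gt_atTop 0] with n hn
    exact hid n hn
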